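/- \textbf{Definitions.} Let $B$ be a bicategory. Its nerve $NB$ is the simplicial set whose $n$-simplices are the normal lax functors $\{0<\dots<n\}\to B$ (lax functors that strictly preserve identities). Thus the $0$-simplices are objects, the $1$-simplices are $1$-cells, the $2$-simplices are $2$-cells $gf\Rightarrow h$, the $3$-simplices are commuting tetrahedra of such $2$-cells, and $NB$ is $3$-coskeletal. Duplicial structure on a simplicial object $X$ consists of maps $t_n\colon X_n\to X_n$ ($n\ge 0$) such that $d_0t_{n+1}=d_{n+1}$, $d_it_{n+1}=t_nd_{i-1}$ for $1\le i\le n+1$, $s_0t_n=t_{n+1}^2s_n$, and $s_it_n=t_{n+1}s_{i-1}$ for $1\le i\le n$. Duplicial structure on $B$ means duplicial structure on $NB$. A $2$-cell $\alpha\colon hf\Rightarrow g$ exhibits $f$ as a right lifting of $g$ through $h$ if every $\beta\colon hk\Rightarrow g$ equals $\alpha\circ(h\bar\beta)$ for a unique $\bar\beta\colon k\Rightarrow f$. Identity $2$-cells between composites that involve an identity $1$-cell are understood up to the unit constraints of $B$. Lifting data on $B$ consist of (a) for each object $x$, an object $tx$ and a $1$-cell $\varepsilon_x\colon tx\to x$;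 (b) for each $1$-cell $f\colon a\to x$, a $1$-cell $tf\colon tx\to a$ and a $2$-cell $\varepsilon_f\colon f\cdot tf\Rightarrow\varepsilon_x$ exhibiting $tf$ as a right lifting of $\varepsilon_x$ through $f$; such that, for every object $x$, (c) $t1_x=\varepsilon_x$; (d) $t(t1_x)=1_{tx}$; (e) $\varepsilon_{t1_x}=1_{t1_x}$. The data are normalized if moreover, for every object $x$, (f) $\varepsilon_{1_x}=1_{t1_x}$. \textbf{Theorem.} (1) For every bicategory $B$, duplicial structure on $B$ is equivalent to normalized lifting data on $B$: there is a bijection between the two, under which $tx=t_0(x)$ for every object $x$, $tf=t_1(f)$ for every $1$-cell $f$, and, for every $1$-cell $f$, $\varepsilon_f$ is the $2$-cell underlying the $2$-simplex $t_2(s_1f)$. (2) For arbitrary lifting data on $B$, i.e. satisfying (a)--(e), there is exactly one duplicial structure on $B$ such that $t_0(x)=tx$ for every object $x$, $t_1(f)=tf$ for every $1$-cell $f$, and $t_2(s_1f)$ is given by $\varepsilon_f$ for every $1$-cell $f$ that is not an identity. (3) Every $*$-autonomous monoidal category, regarded as a one-object bicategory, admits duplicial structure. Here a $*$-autonomous category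 is a monoidal category $C$, with unit $i$, equipped with an equivalence $(-)^*\colon C\to C^{\mathrm{op}}$ and bijections $C(x,y^*)\cong C(i,(x\otimes y)^*)$ natural in $x$ and $y$. -/

import Mathlib

open CategoryTheory Bicategory Opposite

universe w v u

open Simplicial in
/-- Duplicial structure on a simplicial object `X`: endomorphisms `t n` of `X _⦋n⦌` with
`d₀ tₙ₊₁ = dₙ₊₁`, `dᵢ tₙ₊₁ = tₙ dᵢ₋₁` for `1 ≤ i ≤ n + 1`, `s₀ tₙ = tₙ₊₁² sₙ` and
`sᵢ tₙ = tₙ₊₁ sᵢ₋₁` for `1 ≤ i ≤ n`. -/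
structure DuplicialStructure {C : Type u} [Category.{v} C] (X : SimplicialObject C) where
  t (n : ℕ) : X _⦋n⦌ ⟶ X _⦋n⦌
  t_δ_zero (n : ℕ) : t (n + 1) ≫ X.δ 0 = X.δ (Fin.last (n + 1))
  t_δ_succ (n : ℕ) (i : Fin (n + 1)) : t (n + 1) ≫ X.δ i.succ = X.δ i.castSucc ≫ t n
  t_σ_zero (n : ℕ) : t n ≫ X.σ 0 = X.σ (Fin.last n) ≫ t (n + 1) ≫ t (n + 1)
  t_σ_succ (n : ℕ) (i : Fin (n + 1)) :
    t (n + 1) ≫ X.σ i.succ = X.σ i.castSucc ≫ t (n + 2)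

/-- An `n`-simplex of the nerve of a bicategory `B`, that is, a normal lax functor from the
ordered set `{0 < ⋯ < n}` to `B`: objects `obj i`, 1-cells `map i j` for `i ≤ j` and 2-cells
`comp i j k` for `i ≤ j ≤ k`, subject to the unit laws and to the commutation, for
`i ≤ j ≤ k ≤ l`, of the diagram defining a 3-simplex. -/
structure BicatSimplex (B : Type u) [Bicategory.{w, v} B] (n : ℕ) where
  obj (i : Fin (n + 1)) : B
  map (i j : Fin (n + 1)) (hij : i ≤ j) : obj i ⟶ obj j
  map_id (i : Fin (n + 1)) : map i i le_rfl = 𝟙 (obj i)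
  comp (i j k : Fin (n + 1)) (hij : i ≤ j) (hjk : j ≤ k) :
    map i j hij ≫ map j k hjk ⟶ map i k (hij.trans hjk)
  id_comp (i j : Fin (n + 1)) (hij : i ≤ j) :
    comp i i j le_rfl hij = eqToHom (map_id i) ▷ map i j hij ≫ (λ_ (map i j hij)).hom
  comp_id (i j : Fin (n + 1)) (hij : i ≤ j) :
    comp i j j hij le_rfl = map i j hij ◁ eqToHom (map_id j) ≫ (ρ_ (map i j hij)).hom
  assoc (i j k l : Fin (n + 1)) (hij : i ≤ j) (hjk : j ≤ k) (hkl : k ≤ l) :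
    comp i j k hij hjk ▷ map k l hkl ≫ comp i k l (hij.trans hjk) hkl =
      (α_ (map i j hij) (map j k hjk) (map k l hkl)).hom ≫
        map i j hij ◁ comp j k l hjk hkl ≫ comp i j l hij (hjk.trans hkl)

namespace BicatSimplex

variable {B : Type u} [Bicategory.{w, v} B]

/-- The action of an order-preserving map on simplices, by precomposition. -/
def precomp {m n : ℕ} (φ : Fin (m + 1) →o Fin (n + 1)) (s : BicatSimplex B n) :
    BicatSimplex B m where
  obj i := s.obj (φ i)
  map i j hij := s.map (φ i) (φ j) (φ.monotone hij)
  map_id i := s.map_id (φ i)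
  comp i j k hij hjk := s.comp (φ i) (φ j) (φ k) (φ.monotone hij) (φ.monotone hjk)
  id_comp i j hij := s.id_comp (φ i) (φ j) (φ.monotone hij)
  comp_id i j hij := s.comp_id (φ i) (φ j) (φ.monotone hij)
  assoc i j k l hij hjk hkl :=
    s.assoc (φ i) (φ j) (φ k) (φ l) (φ.monotone hij) (φ.monotone hjk) (φ.monotone hkl)

theorem assoc_left {x y z : B} {m : x ⟶ x} (p : m = 𝟙 x) (f : x ⟶ y) (g : y ⟶ z)
    {h : x ⟶ z} (c : f ≫ g ⟶ h) :
    (eqToHom p ▷ f ≫ (λ_ f).hom) ▷ g ≫ c =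
      (α_ m f g).hom ≫ m ◁ c ≫ eqToHom p ▷ h ≫ (λ_ h).hom := by
  subst p
  simp

theorem assoc_middle {x y z : B} {m : y ⟶ y} (p : m = 𝟙 y) (f : x ⟶ y) (g : y ⟶ z)
    {h : x ⟶ z} (c : f ≫ g ⟶ h) :
    (f ◁ eqToHom p ≫ (ρ_ f).hom) ▷ g ≫ c =
      (α_ f m g).hom ≫ f ◁ (eqToHom p ▷ g ≫ (λ_ g).hom) ≫ c := by
  subst p
  simp

theorem assoc_right {x y z : B} {m : z ⟶ z} (p : m = 𝟙 z) (f : x ⟶ y) (g : y ⟶ z)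
    {h : x ⟶ z} (c : f ≫ g ⟶ h) :
    c ▷ m ≫ h ◁ eqToHom p ≫ (ρ_ h).hom =
      (α_ f g m).hom ≫ f ◁ (g ◁ eqToHom p ≫ (ρ_ g).hom) ≫ c := by
  subst p
  simp

/-- In dimension at most 2 the last axiom of a simplex follows from the unit laws. -/
def ofLowDim {n : ℕ} (hn : n ≤ 2) (obj : Fin (n + 1) → B)
    (map : ∀ i j : Fin (n + 1), i ≤ j → (obj i ⟶ obj j))
    (map_id : ∀ i : Fin (n + 1), map i i le_rfl = 𝟙 (obj i))
    (comp : ∀ (i j k : Fin (n + 1)) (hij : i ≤ j) (hjk : j ≤ k),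
      map i j hij ≫ map j k hjk ⟶ map i k (hij.trans hjk))
    (id_comp : ∀ (i j : Fin (n + 1)) (hij : i ≤ j),
      comp i i j le_rfl hij = eqToHom (map_id i) ▷ map i j hij ≫ (λ_ (map i j hij)).hom)
    (comp_id : ∀ (i j : Fin (n + 1)) (hij : i ≤ j),
      comp i j j hij le_rfl = map i j hij ◁ eqToHom (map_id j) ≫ (ρ_ (map i j hij)).hom) :
    BicatSimplex B n where
  obj := obj
  map := map
  map_id := map_id
  comp := comp
  id_comp := id_comp
  comp_id := comp_id
  assoc i j k l hij hjk hkl := by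
    have h : i = j ∨ j = k ∨ k = l := by
      simp only [Fin.le_def, Fin.ext_iff] at *
      omega
    rcases h with rfl | rfl | rfl
    · rw [id_comp, id_comp]
      exact assoc_left (map_id i) _ _ _
    · rw [id_comp, comp_id]
      exact assoc_middle (map_id j) _ _ _
    · rw [comp_id, comp_id]
      exact assoc_right (map_id k) _ _ _

/-- The 0-simplex given by an object. -/
def vertex (x : B) : BicatSimplex B 0 :=
  ofLowDim (by decide) (fun _ => x) (fun _ _ _ => 𝟙 x) (fun _ => rfl)
    (fun _ _ _ _ _ => (λ_ (𝟙 x)).hom) (by simp) (by simp [unitors_equal])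

/-- The 1-simplex `0 ⟶ 1` given by a 1-cell. -/
def edge {x y : B} (f : x ⟶ y) : BicatSimplex B 1 :=
  ofLowDim (by decide)
    (fun i => match i with
      | 0 => x
      | 1 => y)
    (fun i j hij => match i, j, hij with
      | 0, 0, _ => 𝟙 x
      | 0, 1, _ => f
      | 1, 1, _ => 𝟙 y
      | 1, 0, hij => absurd hij (by decide))
    (fun i => match i with
      | 0 => rfl
      | 1 => rfl)
    (fun i j k hij hjk => match i, j, k, hij, hjk with
      | 0, 0, 0, _, _ => (λ_ (𝟙 x)).hom
      | 0, 0, 1, _, _ => (λ_ f).hom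
      | 0, 1, 1, _, _ => (ρ_ f).hom
      | 1, 1, 1, _, _ => (λ_ (𝟙 y)).hom
      | 0, 1, 0, _, hjk => absurd hjk (by decide)
      | 1, 0, 0, hij, _ => absurd hij (by decide)
      | 1, 0, 1, hij, _ => absurd hij (by decide)
      | 1, 1, 0, _, hjk => absurd hjk (by decide))
    (fun i j hij => match i, j, hij with
      | 0, 0, _ => by simp
      | 0, 1, _ => by simp
      | 1, 1, _ => by simp
      | 1, 0, hij => absurd hij (by decide))
    (fun i j hij => match i, j, hij with
      | 0, 0, _ => by simp [unitors_equal]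
      | 0, 1, _ => by simp
      | 1, 1, _ => by simp [unitors_equal]
      | 1, 0, hij => absurd hij (by decide))

/-- The 2-simplex `0 ⟶ 1 ⟶ 2` given by a 2-cell `f ≫ g ⟶ h`. -/
def triangle {x y z : B} {f : x ⟶ y} {g : y ⟶ z} {h : x ⟶ z} (α : f ≫ g ⟶ h) :
    BicatSimplex B 2 :=
  ofLowDim (by decide)
    (fun i => match i with
      | 0 => x
      | 1 => y
      | 2 => z)
    (fun i j hij => match i, j, hij with
      | 0, 0, _ => 𝟙 x
      | 0, 1, _ => f
      | 0, 2, _ => h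
      | 1, 1, _ => 𝟙 y
      | 1, 2, _ => g
      | 2, 2, _ => 𝟙 z
      | 1, 0, hij => absurd hij (by decide)
      | 2, 0, hij => absurd hij (by decide)
      | 2, 1, hij => absurd hij (by decide))
    (fun i => match i with
      | 0 => rfl
      | 1 => rfl
      | 2 => rfl)
    (fun i j k hij hjk => match i, j, k, hij, hjk with
      | 0, 0, 0, _, _ => (λ_ (𝟙 x)).hom
      | 0, 0, 1, _, _ => (λ_ f).hom
      | 0, 0, 2, _, _ => (λ_ h).hom
      | 0, 1, 1, _, _ => (ρ_ f).hom
      | 0, 1, 2, _, _ => α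
      | 0, 2, 2, _, _ => (ρ_ h).hom
      | 1, 1, 1, _, _ => (λ_ (𝟙 y)).hom
      | 1, 1, 2, _, _ => (λ_ g).hom
      | 1, 2, 2, _, _ => (ρ_ g).hom
      | 2, 2, 2, _, _ => (λ_ (𝟙 z)).hom
      | 0, 1, 0, _, hjk => absurd hjk (by decide)
      | 0, 2, 0, _, hjk => absurd hjk (by decide)
      | 0, 2, 1, _, hjk => absurd hjk (by decide)
      | 1, 0, 0, hij, _ => absurd hij (by decide)
      | 1, 0, 1, hij, _ => absurd hij (by decide)
      | 1, 0, 2, hij, _ => absurd hij (by decide)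
      | 1, 1, 0, _, hjk => absurd hjk (by decide)
      | 1, 2, 0, _, hjk => absurd hjk (by decide)
      | 1, 2, 1, _, hjk => absurd hjk (by decide)
      | 2, 0, 0, hij, _ => absurd hij (by decide)
      | 2, 0, 1, hij, _ => absurd hij (by decide)
      | 2, 0, 2, hij, _ => absurd hij (by decide)
      | 2, 1, 0, hij, _ => absurd hij (by decide)
      | 2, 1, 1, hij, _ => absurd hij (by decide)
      | 2, 1, 2, hij, _ => absurd hij (by decide)
      | 2, 2, 0, _, hjk => absurd hjk (by decide)
      | 2, 2, 1, _, hjk => absurd hjk (by decide))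
    (fun i j hij => match i, j, hij with
      | 0, 0, _ => by simp
      | 0, 1, _ => by simp
      | 0, 2, _ => by simp
      | 1, 1, _ => by simp
      | 1, 2, _ => by simp
      | 2, 2, _ => by simp
      | 1, 0, hij => absurd hij (by decide)
      | 2, 0, hij => absurd hij (by decide)
      | 2, 1, hij => absurd hij (by decide))
    (fun i j hij => match i, j, hij with
      | 0, 0, _ => by simp [unitors_equal]
      | 0, 1, _ => by simp
      | 0, 2, _ => by simp
      | 1, 1, _ => by simp [unitors_equal]
      | 1, 2, _ => by simp
      | 2, 2, _ => by simp [unitors_equal]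
      | 1, 0, hij => absurd hij (by decide)
      | 2, 0, hij => absurd hij (by decide)
      | 2, 1, hij => absurd hij (by decide))

end BicatSimplex

/-- The (Street, Duskin) nerve of a bicategory, a simplicial set. -/
def bicatNerve (B : Type u) [Bicategory.{w, v} B] : SSet.{max u v w} where
  obj k := BicatSimplex B k.unop.len
  map φ := TypeCat.ofHom (BicatSimplex.precomp φ.unop.toOrderHom)
  map_id _ := rfl
  map_comp _ _ := rfl

/-- Objects `t x`, 1-cells `ε_x : t x ⟶ x` and `t f : t x ⟶ a`, and 2-cells `ε_f` exhibiting
`t f` as a right lifting of `ε_x` through `f`, subject to `t 1_x = ε_x`, `t (t 1_x) = 1_{t x}`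
and `ε_{t 1_x} = 1`. In the last condition, `t (t 1_x)` being an identity, the composite of
`t (t 1_x)` and `t 1_x` is identified with `t 1_x` by the unit constraint of `B`. -/
structure LiftingData (B : Type u) [Bicategory.{w, v} B] where
  tObj (x : B) : B
  eps (x : B) : tObj x ⟶ x
  tMap {a x : B} (f : a ⟶ x) : tObj x ⟶ a
  counit {a x : B} (f : a ⟶ x) : tMap f ≫ f ⟶ eps x
  isRightLifting {a x : B} (f : a ⟶ x) :
    Nonempty (RightLift.IsKan (RightLift.mk (tMap f) (counit f)))
  tMap_id (x : B) : tMap (𝟙 x) = eps x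
  tMap_tMap_id (x : B) : tMap (tMap (𝟙 x)) = 𝟙 (tObj x)
  counit_tMap_id (x : B) :
    counit (tMap (𝟙 x)) =
      eqToHom (tMap_tMap_id x) ▷ tMap (𝟙 x) ≫ (λ_ (tMap (𝟙 x))).hom ≫ eqToHom (tMap_id x)

/-- The 2-cell `ε_{1_x}` is the identity of `t 1_x = ε_x`, up to the unit constraint of `B`. -/
def LiftingData.IsNormalized {B : Type u} [Bicategory.{w, v} B] (L : LiftingData B) : Prop :=
  ∀ x : B, L.counit (𝟙 x) = (ρ_ (L.tMap (𝟙 x))).hom ≫ eqToHom (L.tMap_id x)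

open scoped MonoidalCategory in
/-- A `*`-autonomous structure on a (not necessarily symmetric) monoidal category `C`: an
equivalence `(-)* : C ≌ Cᵒᵖ` and bijections `C(x, y*) ≃ C(𝟙, (x ⊗ y)*)`, natural in `x` and
`y`. -/
structure StarAutonomousStructure (C : Type u) [Category.{v} C] [MonoidalCategory C] where
  star : C ≌ Cᵒᵖ
  homEquiv (x y : C) : (x ⟶ (star.functor.obj y).unop) ≃
    (𝟙_ C ⟶ (star.functor.obj (x ⊗ y)).unop)
  naturality_left {x x' : C} (y : C) (g : x' ⟶ x) (φ : x ⟶ (star.functor.obj y).unop) :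
    homEquiv x' y (g ≫ φ) =
      homEquiv x y φ ≫ (star.functor.map (MonoidalCategory.whiskerRight g y)).unop
  naturality_right (x : C) {y y' : C} (h : y' ⟶ y) (φ : x ⟶ (star.functor.obj y).unop) :
    homEquiv x y' (φ ≫ (star.functor.map h).unop) =
      homEquiv x y φ ≫ (star.functor.map (MonoidalCategory.whiskerLeft x h)).unop

/-!
Write `t f` for the 1-cell and `ε_f` for the 2-cell attached to `f`. The link between the two
structures is the *transpose* of a 2-cell `α : f ≫ g ⟶ h`, a 2-cell `t h ≫ f ⟶ t g`: the action of
`t₂` on the 2-simplex `α`, if a duplicial structure is given, and the factorization of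
`t h ◁ α ≫ ε_h` through the right lifting `ε_g`, if lifting data are given.

From duplicial structure to lifting data. The map `t₃` carries a 3-simplex with boundary
`(a, b, c, d)` to one whose boundary consists of `a` and the transposes of `b`, `c`, `d`
(`DuplicialStructure.CellData.transpose_comm`). Let `ε_f` be the transpose of the right unit
constraint of `f`. Degenerate choices of the 3-simplex show that the transpose of `α` factorizes
`t h ◁ α ≫ ε_h` through `ε_g` and that transposition is natural in `f`; as `t² s₁ = s₀ t`, the
transpose of `ε_f` is an identity. By a Yoneda style argument, `ε_f` then exhibits a right lifting,
the factorization of `β : k ≫ f ⟶ ε_x` being its transpose `k ≅ t ε_x ≫ k ⟶ t f`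
(`DuplicialStructure.CellData.isRightLifting`). The same identities show that transposes, hence
`t₂`, are determined by `ε`. In higher dimensions a simplex is determined by its faces, so `t` is
determined altogether (`DuplicialStructure.Induces.duplicial_unique`).

From normalized lifting data to duplicial structure. Let `t s` have the vertices `t sₙ`, `s₀`, …,
`sₙ₋₁`, with the transposes of the 2-cells `sᵢⱼₙ` as its 2-cells involving the first vertex
(`LiftingData.act`). All duplicial identities are formal except `s₀ t = t² sₙ`, which uses that
both `ε_{1_x}` and `ε_{t 1_x}` are identities (`LiftingData.IsNormalized.degen_zero_act`).

If `f` is an identity, `t₂ s₁ f = t₂ s₀ f = s₁ t₁ f` is degenerate. So lifting data that are not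
normalized may be normalized first, by changing `ε_f` only when `f` is an identity
(`LiftingData.induces_normalize_iff`).

In a `*`-autonomous category put `ε = 𝟙*`. Then `x*` represents `C(- ⊗ x, ε)`, so that it is the
right lifting of `ε` through `x`. By the Yoneda lemma the unit constraint of `ε` corresponds to an
isomorphism `𝟙 ≅ ε*`, so that it exhibits `𝟙` as the right lifting of `ε` through `ε`. Choosing `ε`
and `𝟙` themselves as the liftings through `𝟙` and `ε` makes the unit conditions strict
(`StarAutonomousStructure.nonempty_liftingData`).
-/

/-! ### Equality of simplices of the nerve -/

namespace BicatSimplex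

variable {B : Type u} [Bicategory.{w, v} B]

theorem ext_heq {n : ℕ} {s s' : BicatSimplex B n} (hobj : ∀ i, s.obj i = s'.obj i)
    (hmap : ∀ i j h, HEq (s.map i j h) (s'.map i j h))
    (hcomp : ∀ i j k h h', HEq (s.comp i j k h h') (s'.comp i j k h h')) : s = s' := by
  obtain ⟨obj, map, _, comp, _, _, _⟩ := s
  obtain ⟨obj', map', _, comp', _, _, _⟩ := s'
  obtain rfl : obj = obj' := funext hobj
  obtain rfl : map = map' := by
    funext i j h
    exact eq_of_heq (hmap i j h)
  obtain rfl : comp = comp' := by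
    funext i j k h h'
    exact eq_of_heq (hcomp i j k h h')
  rfl

theorem obj_congr {n : ℕ} {s s' : BicatSimplex B n} (h : s = s') (i) : s.obj i = s'.obj i := by
  rw [h]

theorem map_heq {n : ℕ} {s s' : BicatSimplex B n} (h : s = s') (i j hij) :
    HEq (s.map i j hij) (s'.map i j hij) := by
  rw [h]

theorem comp_heq {n : ℕ} {s s' : BicatSimplex B n} (h : s = s') (i j k hij hjk) :
    HEq (s.comp i j k hij hjk) (s'.comp i j k hij hjk) := by
  rw [h]

theorem id_comp_heq {n : ℕ} (s : BicatSimplex B n) {i j k} (hij : i ≤ j) (hjk : j ≤ k)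
    (e : i = j) : HEq (s.comp i j k hij hjk) (λ_ (s.map i k (hij.trans hjk))).hom := by
  subst e
  rw [s.id_comp]
  generalize_proofs p
  revert p
  generalize s.map i i le_rfl = m
  rintro rfl
  simp

theorem comp_id_heq {n : ℕ} (s : BicatSimplex B n) {i j k} (hij : i ≤ j) (hjk : j ≤ k)
    (e : j = k) : HEq (s.comp i j k hij hjk) (ρ_ (s.map i k (hij.trans hjk))).hom := by
  subst e
  rw [s.comp_id]
  generalize_proofs p
  revert p
  generalize s.map j j le_rfl = m
  rintro rfl
  simp

/-- A simplex is determined by its non-degenerate data. -/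
theorem ext_of_lt {n : ℕ} {s s' : BicatSimplex B n} (hobj : ∀ i, s.obj i = s'.obj i)
    (hmap : ∀ i j (h : i < j), HEq (s.map i j h.le) (s'.map i j h.le))
    (hcomp : ∀ i j k (h : i < j) (h' : j < k),
      HEq (s.comp i j k h.le h'.le) (s'.comp i j k h.le h'.le)) : s = s' := by
  have hm : ∀ i j h, HEq (s.map i j h) (s'.map i j h) := by
    intro i j h
    rcases h.lt_or_eq with h | rfl
    · exact hmap i j h
    · rw [s.map_id, s'.map_id, hobj]
  have hl : ∀ {x y x' y' : B} {f : x ⟶ y} {f' : x' ⟶ y'}, x = x' → y = y' → HEq f f' →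
      HEq (λ_ f).hom (λ_ f').hom ∧ HEq (ρ_ f).hom (ρ_ f').hom := by
    rintro x y _ _ f _ rfl rfl rfl
    exact ⟨.rfl, .rfl⟩
  refine ext_heq hobj hm fun i j k h h' => ?_
  rcases h.lt_or_eq with h | e
  · rcases h'.lt_or_eq with h' | e
    · exact hcomp i j k h h'
    · exact (s.comp_id_heq _ _ e).trans
        ((hl (hobj _) (hobj _) (hm _ _ _)).2.trans (s'.comp_id_heq _ _ e).symm)
  · exact (s.id_comp_heq _ _ e).trans
        ((hl (hobj _) (hobj _) (hm _ _ _)).1.trans (s'.id_comp_heq _ _ e).symm)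

theorem eq_vertex (s : BicatSimplex B 0) : s = vertex (s.obj 0) :=
  ext_of_lt (fun i => match i with | 0 => rfl) (fun _ _ h => absurd h (by omega))
    (fun _ _ _ h => absurd h (by omega))

theorem eq_edge (s : BicatSimplex B 1) : s = edge (s.map 0 1 (by decide)) := by
  refine ext_of_lt (fun i => ?_) (fun i j h => ?_) (fun i j k h h' => absurd h' (by omega))
  · fin_cases i <;> rfl
  · fin_cases i <;> fin_cases j <;> first | exact absurd h (by decide) | exact HEq.rfl

theorem eq_of_lt_of_lt {i j k : Fin 3} (h : i < j) (h' : j < k) : i = 0 ∧ j = 1 ∧ k = 2 := by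
  simp only [Fin.ext_iff, Fin.lt_def] at h h' ⊢
  have := k.isLt
  norm_num
  omega

theorem eq_triangle (s : BicatSimplex B 2) :
    s = triangle (s.comp 0 1 2 (by decide) (by decide)) := by
  refine ext_of_lt (fun i => ?_) (fun i j h => ?_) (fun i j k h h' => ?_)
  · fin_cases i <;> rfl
  · fin_cases i <;> fin_cases j <;> first | exact absurd h (by decide) | exact HEq.rfl
  · obtain ⟨rfl, rfl, rfl⟩ := eq_of_lt_of_lt h h'
    exact HEq.rfl

theorem vertex_injective : Function.Injective (vertex : B → BicatSimplex B 0) :=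
  fun _ _ h => obj_congr h 0

theorem edge_eq_iff {x y x' y' : B} {f : x ⟶ y} {f' : x' ⟶ y'} :
    edge f = edge f' ↔ x = x' ∧ y = y' ∧ HEq f f' := by
  constructor
  · intro h
    exact ⟨obj_congr h 0, obj_congr h 1, map_heq h 0 1 (by decide)⟩
  · rintro ⟨rfl, rfl, rfl⟩
    rfl

theorem edge_injective {x y : B} : Function.Injective (edge : (x ⟶ y) → BicatSimplex B 1) :=
  fun _ _ h => eq_of_heq (edge_eq_iff.1 h).2.2

theorem triangle_eq_iff {x y z x' y' z' : B} {f : x ⟶ y} {g : y ⟶ z} {h : x ⟶ z}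
    {α : f ≫ g ⟶ h} {f' : x' ⟶ y'} {g' : y' ⟶ z'} {h' : x' ⟶ z'} {α' : f' ≫ g' ⟶ h'} :
    triangle α = triangle α' ↔
      x = x' ∧ y = y' ∧ z = z' ∧ HEq f f' ∧ HEq g g' ∧ HEq h h' ∧ HEq α α' := by
  constructor
  · intro e
    exact ⟨obj_congr e 0, obj_congr e 1, obj_congr e 2, map_heq e 0 1 (by decide),
      map_heq e 1 2 (by decide), map_heq e 0 2 (by decide),
      comp_heq e 0 1 2 (by decide) (by decide)⟩
  · rintro ⟨rfl, rfl, rfl, rfl, rfl, rfl, rfl⟩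
    rfl

theorem triangle_injective {x y z : B} {f : x ⟶ y} {g : y ⟶ z} {h : x ⟶ z} :
    Function.Injective (triangle : (f ≫ g ⟶ h) → BicatSimplex B 2) :=
  fun _ _ h => eq_of_heq (triangle_eq_iff.1 h).2.2.2.2.2.2

/-- Comparison of 2-simplices whose first and third edges agree only propositionally. -/
theorem triangle_eq_iff_cast {x y z : B} {f f' : x ⟶ y} {g : y ⟶ z} {h h' : x ⟶ z}
    {α : f ≫ g ⟶ h} {α' : f' ≫ g ⟶ h'} (p : f = f') (q : h = h') :
    triangle α = triangle α' ↔ α = eqToHom p ▷ g ≫ α' ≫ eqToHom q.symm := by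
  subst p q
  simpa using triangle_injective.eq_iff

theorem triangle_comp_eqToHom {x y z : B} {f : x ⟶ y} {g : y ⟶ z} {h h' : x ⟶ z}
    (α : f ≫ g ⟶ h) (q : h = h') : triangle (α ≫ eqToHom q) = triangle α := by
  subst q
  simp

/-! ### Faces and degeneracies in low dimensions -/

/-- The face opposite to the vertex `i`. -/
abbrev face {n : ℕ} (i : Fin (n + 2)) (s : BicatSimplex B (n + 1)) : BicatSimplex B n :=
  s.precomp (SimplexCategory.δ i).toOrderHom

/-- The degeneracy repeating the vertex `i`. -/
abbrev degen {n : ℕ} (i : Fin (n + 1)) (s : BicatSimplex B n) : BicatSimplex B (n + 1) :=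
  s.precomp (SimplexCategory.σ i).toOrderHom

theorem face_one_edge {x y : B} (f : x ⟶ y) : face 1 (edge f) = vertex x := eq_vertex _

theorem face_zero_edge {x y : B} (f : x ⟶ y) : face 0 (edge f) = vertex y := eq_vertex _

theorem degen_zero_vertex (x : B) : degen 0 (vertex x) = edge (𝟙 x) := eq_edge _

theorem degen_zero_edge {x y : B} (f : x ⟶ y) : degen 0 (edge f) = triangle (λ_ f).hom :=
  eq_triangle _

theorem degen_one_edge {x y : B} (f : x ⟶ y) : degen 1 (edge f) = triangle (ρ_ f).hom :=
  eq_triangle _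

section

variable {x y z : B} {f : x ⟶ y} {g : y ⟶ z} {h : x ⟶ z} (α : f ≫ g ⟶ h)

theorem face_zero_triangle : face 0 (triangle α) = edge g := eq_edge _

theorem face_one_triangle : face 1 (triangle α) = edge h := eq_edge _

theorem face_two_triangle : face 2 (triangle α) = edge f := eq_edge _

end

/-- A 1-simplex with prescribed vertices is given by a 1-cell. -/
theorem exists_eq_edge {x y : B} {s : BicatSimplex B 1} (hx : face 1 s = vertex x)
    (hy : face 0 s = vertex y) : ∃ f : x ⟶ y, s = edge f := by
  rw [eq_edge s] at hx hy ⊢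
  rw [face_one_edge] at hx
  rw [face_zero_edge] at hy
  obtain rfl := vertex_injective hx
  obtain rfl := vertex_injective hy
  exact ⟨_, rfl⟩

/-- A 2-simplex with prescribed edges is given by a 2-cell. -/
theorem exists_eq_triangle {x y z : B} {f : x ⟶ y} {g : y ⟶ z} {h : x ⟶ z}
    {s : BicatSimplex B 2} (hf : face 2 s = edge f) (hg : face 0 s = edge g)
    (hh : face 1 s = edge h) : ∃ α : f ≫ g ⟶ h, s = triangle α := by
  have aux : ∀ {x' y' z' : B} {f' : x' ⟶ y'} {g' : y' ⟶ z'} {h' : x' ⟶ z'} (α : f' ≫ g' ⟶ h'),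
      edge f' = edge f → edge g' = edge g → edge h' = edge h →
      ∃ β : f ≫ g ⟶ h, triangle α = triangle β := by
    intro x' y' z' f' g' h' α hf hg hh
    obtain ⟨rfl, rfl, rfl⟩ := edge_eq_iff.1 hf
    obtain ⟨-, rfl, rfl⟩ := edge_eq_iff.1 hg
    obtain ⟨-, -, rfl⟩ := edge_eq_iff.1 hh
    exact ⟨α, rfl⟩
  rw [eq_triangle s] at hf hg hh ⊢
  rw [face_two_triangle] at hf
  rw [face_zero_triangle] at hg
  rw [face_one_triangle] at hh
  exact aux _ hf hg hh

/-- In dimension at least 3, a simplex is determined by its faces. -/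
theorem ext_face {n : ℕ} {s s' : BicatSimplex B (n + 3)} (h : ∀ i, face i s = face i s') :
    s = s' := by
  -- Any three vertices lie in a common face.
  have key : ∀ i j k : Fin (n + 4), ∃ l, l ≠ i ∧ l ≠ j ∧ l ≠ k := by
    intro i j k
    obtain ⟨l, hl⟩ := Finset.exists_mem_notMem_of_card_lt_card (s := {i, j, k})
      (t := (Finset.univ : Finset (Fin (n + 4))))
      ((Finset.card_le_three).trans_lt (by simp))
    exact ⟨l, by simpa using hl.2⟩
  have hc : ∀ i j k hij hjk, s.obj i = s'.obj i ∧ HEq (s.map i j hij) (s'.map i j hij) ∧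
      HEq (s.comp i j k hij hjk) (s'.comp i j k hij hjk) := by
    intro i j k hij hjk
    obtain ⟨l, hi, hj, hk⟩ := key i j k
    obtain ⟨i, rfl⟩ := Fin.exists_succAbove_eq hi.symm
    obtain ⟨j, rfl⟩ := Fin.exists_succAbove_eq hj.symm
    obtain ⟨k, rfl⟩ := Fin.exists_succAbove_eq hk.symm
    have hij' : i ≤ j := Fin.succAbove_le_succAbove_iff.1 hij
    have hjk' : j ≤ k := Fin.succAbove_le_succAbove_iff.1 hjk
    exact ⟨obj_congr (h l) i, map_heq (h l) i j hij', comp_heq (h l) i j k hij' hjk'⟩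
  exact ext_heq (fun i => (hc i i i le_rfl le_rfl).1) (fun i j h => (hc i j j h le_rfl).2.1)
    fun i j k h h' => (hc i j k h h').2.2

/-! ### Cones and tetrahedra -/

section

variable {x y z : B} (f : x ⟶ y) (g : y ⟶ z)

theorem leftUnitor_hom_eq :
    (λ_ f).hom = eqToHom (rfl : 𝟙 x = 𝟙 x) ▷ f ≫ (λ_ f).hom := by simp

theorem rightUnitor_hom_eq :
    (ρ_ f).hom = f ◁ eqToHom (rfl : 𝟙 y = 𝟙 y) ≫ (ρ_ f).hom := by simp

theorem leftUnitor_whiskerRight_comp {h : x ⟶ z} (c : f ≫ g ⟶ h) :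
    (λ_ f).hom ▷ g ≫ c = (α_ (𝟙 x) f g).hom ≫ 𝟙 x ◁ c ≫ (λ_ h).hom := by simp

theorem whiskerRight_comp_rightUnitor {h : x ⟶ z} (c : f ≫ g ⟶ h) :
    c ▷ 𝟙 z ≫ (ρ_ h).hom = (α_ f g (𝟙 z)).hom ≫ f ◁ (ρ_ g).hom ≫ c := by simp

end

section Cone

variable {N n : ℕ} (s : BicatSimplex B N) (θ : Fin n →o Fin (N + 1)) (x : B)
  (p : ∀ i, x ⟶ s.obj (θ i))
  (q : ∀ i j (h : i ≤ j), p i ≫ s.map (θ i) (θ j) (θ.monotone h) ⟶ p j)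

/-- The last axiom of a simplex need only be checked on strictly increasing vertices. -/
theorem cone_assoc
    (q_id : ∀ i, q i i le_rfl = p i ◁ eqToHom (s.map_id (θ i)) ≫ (ρ_ (p i)).hom)
    (q_assoc : ∀ i j k (hij : i < j) (hjk : j < k),
      q i j hij.le ▷ s.map (θ j) (θ k) (θ.monotone hjk.le) ≫ q j k hjk.le =
        (α_ _ _ _).hom ≫ p i ◁ s.comp (θ i) (θ j) (θ k) (θ.monotone hij.le) (θ.monotone hjk.le) ≫
          q i k (hij.trans hjk).le)
    (i j k) (hij : i ≤ j) (hjk : j ≤ k) :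
    q i j hij ▷ s.map (θ j) (θ k) (θ.monotone hjk) ≫ q j k hjk =
      (α_ _ _ _).hom ≫ p i ◁ s.comp (θ i) (θ j) (θ k) (θ.monotone hij) (θ.monotone hjk) ≫
        q i k (hij.trans hjk) := by
  rcases hij.lt_or_eq with hij | rfl
  · rcases hjk.lt_or_eq with hjk | rfl
    · exact q_assoc i j k hij hjk
    · rw [q_id, s.comp_id]
      exact assoc_right (s.map_id _) _ _ _
  · rw [q_id, s.id_comp]
    exact assoc_middle (s.map_id _) _ _ _

/-- The `n`-simplex with initial vertex `x` and the remaining vertices given by the restriction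
along `θ` of a simplex `s`. Restricting along `θ` rather than starting from an
`(n - 1)`-simplex covers the case `n = 0`. -/
def cone
    (q_id : ∀ i, q i i le_rfl = p i ◁ eqToHom (s.map_id (θ i)) ≫ (ρ_ (p i)).hom)
    (q_assoc : ∀ i j k (hij : i < j) (hjk : j < k),
      q i j hij.le ▷ s.map (θ j) (θ k) (θ.monotone hjk.le) ≫ q j k hjk.le =
        (α_ _ _ _).hom ≫ p i ◁ s.comp (θ i) (θ j) (θ k) (θ.monotone hij.le) (θ.monotone hjk.le) ≫
          q i k (hij.trans hjk).le) :
    BicatSimplex B n where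
  obj i := match i with
    | ⟨0, _⟩ => x
    | ⟨i + 1, hi⟩ => s.obj (θ ⟨i, Nat.lt_of_succ_lt_succ hi⟩)
  map i j hij := match i, j, hij with
    | ⟨0, _⟩, ⟨0, _⟩, _ => 𝟙 x
    | ⟨0, _⟩, ⟨j + 1, hj⟩, _ => p ⟨j, Nat.lt_of_succ_lt_succ hj⟩
    | ⟨_ + 1, _⟩, ⟨_ + 1, _⟩, hij => s.map _ _ (θ.monotone (Nat.le_of_succ_le_succ hij))
    | ⟨i + 1, _⟩, ⟨0, _⟩, hij => absurd hij (Nat.not_succ_le_zero i)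
  map_id i := match i with
    | ⟨0, _⟩ => rfl
    | ⟨_ + 1, _⟩ => s.map_id _
  comp i j k hij hjk := match i, j, k, hij, hjk with
    | ⟨0, _⟩, ⟨0, _⟩, ⟨0, _⟩, _, _ => (λ_ (𝟙 x)).hom
    | ⟨0, _⟩, ⟨0, _⟩, ⟨k + 1, hk⟩, _, _ => (λ_ (p ⟨k, Nat.lt_of_succ_lt_succ hk⟩)).hom
    | ⟨0, _⟩, ⟨_ + 1, _⟩, ⟨_ + 1, _⟩, _, hjk => q _ _ (Nat.le_of_succ_le_succ hjk)
    | ⟨_ + 1, _⟩, ⟨_ + 1, _⟩, ⟨_ + 1, _⟩, hij, hjk =>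
      s.comp _ _ _ (θ.monotone (Nat.le_of_succ_le_succ hij))
        (θ.monotone (Nat.le_of_succ_le_succ hjk))
    | ⟨i + 1, _⟩, ⟨0, _⟩, _, hij, _ => absurd hij (Nat.not_succ_le_zero i)
    | _, ⟨j + 1, _⟩, ⟨0, _⟩, _, hjk => absurd hjk (Nat.not_succ_le_zero j)
  id_comp i j hij := match i, j, hij with
    | ⟨0, _⟩, ⟨0, _⟩, _ => leftUnitor_hom_eq _
    | ⟨0, _⟩, ⟨_ + 1, _⟩, _ => leftUnitor_hom_eq _
    | ⟨_ + 1, _⟩, ⟨_ + 1, _⟩, _ => s.id_comp _ _ _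
    | ⟨i + 1, _⟩, ⟨0, _⟩, hij => absurd hij (Nat.not_succ_le_zero i)
  comp_id i j hij := match i, j, hij with
    | ⟨0, _⟩, ⟨0, _⟩, _ => unitors_equal.trans (rightUnitor_hom_eq _)
    | ⟨0, _⟩, ⟨_ + 1, _⟩, _ => q_id _
    | ⟨_ + 1, _⟩, ⟨_ + 1, _⟩, _ => s.comp_id _ _ _
    | ⟨i + 1, _⟩, ⟨0, _⟩, hij => absurd hij (Nat.not_succ_le_zero i)
  assoc i j k l hij hjk hkl := match i, j, k, l, hij, hjk, hkl with
    | ⟨0, _⟩, ⟨0, _⟩, ⟨0, _⟩, ⟨0, _⟩, _, _, _ => leftUnitor_whiskerRight_comp _ _ _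
    | ⟨0, _⟩, ⟨0, _⟩, ⟨0, _⟩, ⟨_ + 1, _⟩, _, _, _ => leftUnitor_whiskerRight_comp _ _ _
    | ⟨0, _⟩, ⟨0, _⟩, ⟨_ + 1, _⟩, ⟨_ + 1, _⟩, _, _, _ => leftUnitor_whiskerRight_comp _ _ _
    | ⟨0, _⟩, ⟨_ + 1, _⟩, ⟨_ + 1, _⟩, ⟨_ + 1, _⟩, _, hjk, hkl =>
      cone_assoc s θ x p q q_id q_assoc _ _ _ (Nat.le_of_succ_le_succ hjk)
        (Nat.le_of_succ_le_succ hkl)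
    | ⟨_ + 1, _⟩, ⟨_ + 1, _⟩, ⟨_ + 1, _⟩, ⟨_ + 1, _⟩, _, _, _ => s.assoc _ _ _ _ _ _ _
    | ⟨i + 1, _⟩, ⟨0, _⟩, _, _, hij, _, _ => absurd hij (Nat.not_succ_le_zero i)
    | _, ⟨j + 1, _⟩, ⟨0, _⟩, _, _, hjk, _ => absurd hjk (Nat.not_succ_le_zero j)
    | _, _, ⟨k + 1, _⟩, ⟨0, _⟩, _, _, hkl => absurd hkl (Nat.not_succ_le_zero k)

end Cone

section Tetrahedron

variable {x₀ x₁ x₂ x₃ : B} {f : x₀ ⟶ x₁} {g : x₁ ⟶ x₂} {h : x₂ ⟶ x₃} {fg : x₀ ⟶ x₂}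
  {gh : x₁ ⟶ x₃} {fgh : x₀ ⟶ x₃} {a : f ≫ g ⟶ fg} {b : g ≫ h ⟶ gh} {c : fg ≫ h ⟶ fgh}
  {d : f ≫ gh ⟶ fgh}

/-- A commuting tetrahedron of 2-cells is the boundary of a 3-simplex. -/
theorem exists_tetrahedron (e : a ▷ h ≫ c = (α_ f g h).hom ≫ f ◁ b ≫ d) :
    ∃ s : BicatSimplex B 3, face 3 s = triangle a ∧ face 0 s = triangle b ∧
      face 1 s = triangle c ∧ face 2 s = triangle d := by
  refine ⟨cone (triangle b) OrderHom.id x₀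
    (fun i => match i with
      | 0 => f
      | 1 => fg
      | 2 => fgh)
    (fun i j hij => match i, j, hij with
      | 0, 0, _ => (ρ_ f).hom
      | 0, 1, _ => a
      | 0, 2, _ => d
      | 1, 1, _ => (ρ_ fg).hom
      | 1, 2, _ => c
      | 2, 2, _ => (ρ_ fgh).hom
      | 1, 0, hij => absurd hij (by decide)
      | 2, 0, hij => absurd hij (by decide)
      | 2, 1, hij => absurd hij (by decide)) ?_ ?_,
    eq_triangle _, eq_triangle _, eq_triangle _, eq_triangle _⟩
  · intro i
    match i with
    | 0 => exact rightUnitor_hom_eq f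
    | 1 => exact rightUnitor_hom_eq fg
    | 2 => exact rightUnitor_hom_eq fgh
  · intro i j k hij hjk
    obtain ⟨rfl, rfl, rfl⟩ := eq_of_lt_of_lt hij hjk
    exact e

/-- The 2-cells bounding a 3-simplex form a commuting tetrahedron. -/
theorem tetrahedron_comm {s : BicatSimplex B 3} (h₃ : face 3 s = triangle a)
    (h₀ : face 0 s = triangle b) (h₁ : face 1 s = triangle c) (h₂ : face 2 s = triangle d) :
    a ▷ h ≫ c = (α_ f g h).hom ≫ f ◁ b ≫ d := by
  have aux : ∀ {y₀ y₁ y₂ y₃ : B} {f' : y₀ ⟶ y₁} {g' : y₁ ⟶ y₂} {h' : y₂ ⟶ y₃} {fg' : y₀ ⟶ y₂}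
      {gh' : y₁ ⟶ y₃} {fgh' : y₀ ⟶ y₃} {a' : f' ≫ g' ⟶ fg'} {b' : g' ≫ h' ⟶ gh'}
      {c' : fg' ≫ h' ⟶ fgh'} {d' : f' ≫ gh' ⟶ fgh'},
      a' ▷ h' ≫ c' = (α_ f' g' h').hom ≫ f' ◁ b' ≫ d' →
      triangle a' = triangle a → triangle b' = triangle b → triangle c' = triangle c →
      triangle d' = triangle d → a ▷ h ≫ c = (α_ f g h).hom ≫ f ◁ b ≫ d := by
    intro _ _ _ _ _ _ _ _ _ _ _ _ _ _ e ha hb hc hd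
    obtain ⟨rfl, rfl, rfl, rfl, rfl, rfl, rfl⟩ := triangle_eq_iff.1 ha
    obtain ⟨-, -, rfl, -, rfl, rfl, rfl⟩ := triangle_eq_iff.1 hb
    obtain ⟨-, -, -, -, -, rfl, rfl⟩ := triangle_eq_iff.1 hc
    obtain ⟨-, -, -, -, -, -, rfl⟩ := triangle_eq_iff.1 hd
    exact e
  exact aux (s.assoc 0 1 2 3 (by decide) (by decide) (by decide))
    ((eq_triangle _).symm.trans h₃) ((eq_triangle _).symm.trans h₀)
    ((eq_triangle _).symm.trans h₁) ((eq_triangle _).symm.trans h₂)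

end Tetrahedron

end BicatSimplex

/-! ### Right liftings -/

section Lifting

variable {B : Type u} [Bicategory.{w, v} B]

/-- The universal property of a right lifting, as a bijection on 2-cells. -/
theorem nonempty_isKan_iff {a x z : B} {f : a ⟶ x} {g : z ⟶ x} {h : z ⟶ a} {c : h ≫ f ⟶ g} :
    Nonempty (RightLift.IsKan (RightLift.mk h c)) ↔
      ∀ (k : z ⟶ a) (β : k ≫ f ⟶ g), ∃! γ : k ⟶ h, γ ▷ f ≫ c = β := by
  constructor
  · rintro ⟨H⟩ k β
    refine ⟨H.desc (RightLift.mk k β), H.fac (RightLift.mk k β), fun γ hγ => H.hom_ext ?_⟩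
    exact hγ.trans (H.fac (RightLift.mk k β)).symm
  · intro H
    choose d hd hu using H
    refine ⟨RightLift.IsKan.mk (fun s => RightLift.homMk (d s.lift s.counit) (hd _ _))
      fun s τ => ?_⟩
    ext
    exact hu _ _ _ (RightLift.w τ)

/-- The identity 2-cell exhibits any 1-cell as its own right lifting through an identity. -/
theorem nonempty_isKan_rightUnitor {z x : B} (g : z ⟶ x) :
    Nonempty (RightLift.IsKan (RightLift.mk g (ρ_ g).hom)) := by
  rw [nonempty_isKan_iff]
  intro k β
  refine ⟨(ρ_ k).inv ≫ β, by simp, fun γ hγ => ?_⟩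
  simp [← hγ]

end Lifting

/-! ### Duplicial structures on the nerve -/

namespace DuplicialStructure

open BicatSimplex

variable {B : Type u} [Bicategory.{w, v} B] (D : DuplicialStructure (bicatNerve B))

/-- The action of a duplicial structure on the nerve of `B`, as a function on simplices. -/
def act (n : ℕ) (s : BicatSimplex B n) : BicatSimplex B n := D.t n s

theorem face_zero_act {n : ℕ} (s : BicatSimplex B (n + 1)) :
    face 0 (D.act (n + 1) s) = face (Fin.last (n + 1)) s :=
  ConcreteCategory.congr_hom (D.t_δ_zero n) s

theorem face_succ_act {n : ℕ} (i : Fin (n + 1)) (s : BicatSimplex B (n + 1)) :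
    face i.succ (D.act (n + 1) s) = D.act n (face i.castSucc s) :=
  ConcreteCategory.congr_hom (D.t_δ_succ n i) s

theorem degen_zero_act {n : ℕ} (s : BicatSimplex B n) :
    degen 0 (D.act n s) = D.act (n + 1) (D.act (n + 1) (degen (Fin.last n) s)) :=
  ConcreteCategory.congr_hom (D.t_σ_zero n) s

theorem degen_succ_act {n : ℕ} (i : Fin (n + 1)) (s : BicatSimplex B (n + 1)) :
    degen i.succ (D.act (n + 1) s) = D.act (n + 2) (degen i.castSucc s) :=
  ConcreteCategory.congr_hom (D.t_σ_succ n i) s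

/-- A duplicial structure is determined by its action in dimensions at most 2. -/
theorem ext_of_act {D D' : DuplicialStructure (bicatNerve B)}
    (h : ∀ n ≤ 2, ∀ s, D.act n s = D'.act n s) : D = D' := by
  have key : ∀ n s, D.act n s = D'.act n s := by
    intro n
    induction n with
    | zero => exact h 0 (by decide)
    | succ n ih =>
      intro s
      by_cases hn : n + 1 ≤ 2
      · exact h _ hn s
      · obtain ⟨n, rfl⟩ : ∃ k, n = k + 2 := ⟨n - 2, by omega⟩
        refine ext_face fun i => ?_
        refine Fin.cases ?_ (fun i => ?_) i
        · rw [face_zero_act, face_zero_act]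
        · rw [face_succ_act, face_succ_act, ih]
  have ht : D.t = D'.t := by
    funext n
    ext s
    exact key n s
  cases D
  cases D'
  cases ht
  rfl

/-- The objects `t x` and 1-cells `t f` by which a duplicial structure acts on the 0- and
1-simplices of the nerve. -/
structure CellData where
  tObj (x : B) : B
  tMap {a x : B} (f : a ⟶ x) : tObj x ⟶ a
  act_vertex (x : B) : D.act 0 (vertex x) = vertex (tObj x)
  act_edge {a x : B} (f : a ⟶ x) : D.act 1 (edge f) = edge (tMap f)

theorem nonempty_cellData : Nonempty D.CellData := by
  have h (x : B) : D.act 0 (vertex x) = vertex ((D.act 0 (vertex x)).obj 0) := eq_vertex _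
  have h' {a x : B} (f : a ⟶ x) :
      ∃ g : (D.act 0 (vertex x)).obj 0 ⟶ a, D.act 1 (edge f) = edge g := by
    refine exists_eq_edge ?_ ?_
    · exact (D.face_succ_act 0 (edge f)).trans ((congrArg _ (face_zero_edge f)).trans (h x))
    · exact (D.face_zero_act (edge f)).trans (face_one_edge f)
  choose tMap hMap using @h'
  exact ⟨⟨_, tMap, h, hMap⟩⟩

namespace CellData

variable {D} (E : D.CellData)

theorem exists_act_triangle {x y z : B} {f : x ⟶ y} {g : y ⟶ z} {h : x ⟶ z} (α : f ≫ g ⟶ h) :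
    ∃ β : E.tMap h ≫ f ⟶ E.tMap g, D.act 2 (triangle α) = triangle β := by
  refine exists_eq_triangle ?_ ?_ ?_
  · exact (D.face_succ_act 1 (triangle α)).trans
      ((congrArg _ (face_one_triangle α)).trans (E.act_edge h))
  · exact (D.face_zero_act (triangle α)).trans (face_two_triangle α)
  · exact (D.face_succ_act 0 (triangle α)).trans
      ((congrArg _ (face_zero_triangle α)).trans (E.act_edge g))

/-- The 2-cell `t h ≫ f ⟶ t g` into which a duplicial structure turns a 2-cell `f ≫ g ⟶ h`. -/
noncomputable def transpose {x y z : B} {f : x ⟶ y} {g : y ⟶ z} {h : x ⟶ z} (α : f ≫ g ⟶ h) :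
    E.tMap h ≫ f ⟶ E.tMap g :=
  (E.exists_act_triangle α).choose

theorem act_triangle {x y z : B} {f : x ⟶ y} {g : y ⟶ z} {h : x ⟶ z} (α : f ≫ g ⟶ h) :
    D.act 2 (triangle α) = triangle (E.transpose α) :=
  (E.exists_act_triangle α).choose_spec

/-- A duplicial structure sends the boundary of a 3-simplex to the boundary of a 3-simplex. -/
theorem transpose_comm {x₀ x₁ x₂ x₃ : B} {f : x₀ ⟶ x₁} {g : x₁ ⟶ x₂} {h : x₂ ⟶ x₃}
    {fg : x₀ ⟶ x₂} {gh : x₁ ⟶ x₃} {fgh : x₀ ⟶ x₃} {a : f ≫ g ⟶ fg} {b : g ≫ h ⟶ gh}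
    {c : fg ≫ h ⟶ fgh} {d : f ≫ gh ⟶ fgh}
    (e : a ▷ h ≫ c = (α_ f g h).hom ≫ f ◁ b ≫ d) :
    E.transpose d ▷ g ≫ E.transpose b =
      (α_ (E.tMap fgh) f g).hom ≫ E.tMap fgh ◁ a ≫ E.transpose c := by
  obtain ⟨s, h₃, h₀, h₁, h₂⟩ := exists_tetrahedron e
  refine tetrahedron_comm (s := D.act 3 s) ?_ ?_ ?_ ?_
  · exact (D.face_succ_act 2 s).trans ((congrArg _ h₂).trans (E.act_triangle d))
  · exact (D.face_zero_act s).trans h₃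
  · exact (D.face_succ_act 0 s).trans ((congrArg _ h₀).trans (E.act_triangle b))
  · exact (D.face_succ_act 1 s).trans ((congrArg _ h₁).trans (E.act_triangle c))

theorem transpose_leftUnitor {x y : B} (f : x ⟶ y) :
    E.transpose (λ_ f).hom = (ρ_ (E.tMap f)).hom := by
  apply triangle_injective
  rw [← E.act_triangle, ← degen_zero_edge, ← degen_one_edge, ← E.act_edge]
  exact (D.degen_succ_act 0 (edge f)).symm

theorem tMap_tMap_id (x : B) : E.tMap (E.tMap (𝟙 x)) = 𝟙 (E.tObj x) := by
  apply edge_injective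
  rw [← E.act_edge, ← E.act_edge, ← degen_zero_vertex, ← degen_zero_vertex, ← E.act_vertex]
  exact (D.degen_zero_act (vertex x)).symm

/-- The 2-cell `ε_f`, with codomain `t 1_x`. -/
noncomputable abbrev counit {a x : B} (f : a ⟶ x) : E.tMap f ≫ f ⟶ E.tMap (𝟙 x) :=
  E.transpose (ρ_ f).hom

theorem act_degen_one_edge {a x : B} (f : a ⟶ x) :
    D.act 2 (degen 1 (edge f)) = triangle (E.counit f) := by
  rw [degen_one_edge, E.act_triangle]

theorem counit_id (x : B) : E.counit (𝟙 x) = (ρ_ (E.tMap (𝟙 x))).hom := by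
  rw [← E.transpose_leftUnitor, unitors_equal]

/-- Since `t² s₁ = s₀ t` on 1-simplices, transposing `ε_f` gives an identity. -/
theorem transpose_counit {a x : B} (f : a ⟶ x) :
    E.transpose (E.counit f) = eqToHom (E.tMap_tMap_id x) ▷ E.tMap f ≫ (λ_ (E.tMap f)).hom := by
  have h : triangle (E.transpose (E.counit f)) = triangle (λ_ (E.tMap f)).hom := by
    rw [← E.act_triangle, ← E.act_degen_one_edge, ← degen_zero_edge, ← E.act_edge]
    exact (D.degen_zero_act (edge f)).symm
  simpa using (triangle_eq_iff_cast (E.tMap_tMap_id x) rfl).1 h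

theorem counit_tMap_id (x : B) :
    E.counit (E.tMap (𝟙 x)) =
      eqToHom (E.tMap_tMap_id x) ▷ E.tMap (𝟙 x) ≫ (λ_ (E.tMap (𝟙 x))).hom := by
  rw [← E.transpose_counit, E.counit_id]

/-- The transpose of a 2-cell factorizes it through `ε`. -/
theorem transpose_whiskerRight_counit {x y z : B} {f : x ⟶ y} {g : y ⟶ z} {h : x ⟶ z}
    (α : f ≫ g ⟶ h) :
    E.transpose α ▷ g ≫ E.counit g =
      (α_ (E.tMap h) f g).hom ≫ E.tMap h ◁ α ≫ E.counit h :=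
  E.transpose_comm (whiskerRight_comp_rightUnitor f g α)

/-- Transposition is natural in the first of the two composed 1-cells. -/
theorem transpose_whiskerRight {x y z : B} {f f' : x ⟶ y} {g : y ⟶ z} {h : x ⟶ z}
    (γ : f' ⟶ f) (α : f ≫ g ⟶ h) :
    E.transpose (γ ▷ g ≫ α) = E.tMap h ◁ γ ≫ E.transpose α := by
  -- The 3-simplex has its edge from 0 to 1 degenerate.
  have key := E.transpose_comm (a := (λ_ f').hom ≫ γ) (b := γ ▷ g ≫ α) (c := α)
    (d := (λ_ h).hom) (by simp)
  rw [E.transpose_leftUnitor] at key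
  exact (cancel_epi ((ρ_ (E.tMap h)).hom ▷ f')).1 (by simpa using key)

/-- The 2-cells `ε_f` exhibit right liftings: the factorization of `β` is its transpose. -/
theorem isRightLifting {a x : B} (f : a ⟶ x) :
    Nonempty (RightLift.IsKan (RightLift.mk (E.tMap f) (E.counit f))) := by
  rw [nonempty_isKan_iff]
  intro k β
  refine ⟨(λ_ k).inv ≫ eqToHom (E.tMap_tMap_id x).symm ▷ k ≫ E.transpose β, ?_, ?_⟩
  · have h := E.transpose_whiskerRight_counit β
    rw [E.counit_tMap_id] at h
    simp only [comp_whiskerRight, Category.assoc, h]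
    have : ∀ {m : E.tObj x ⟶ E.tObj x} (p : m = 𝟙 _),
        (λ_ k).inv ▷ f ≫ eqToHom p.symm ▷ k ▷ f ≫ (α_ m k f).hom ≫ m ◁ β ≫
          eqToHom p ▷ E.tMap (𝟙 x) ≫ (λ_ (E.tMap (𝟙 x))).hom = β := by
      rintro _ rfl
      simp
    exact this _
  · rintro γ rfl
    rw [E.transpose_whiskerRight, E.transpose_counit]
    have : ∀ {m : E.tObj x ⟶ E.tObj x} (p : m = 𝟙 _),
        γ = (λ_ k).inv ≫ eqToHom p.symm ▷ k ≫ m ◁ γ ≫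
          eqToHom p ▷ E.tMap f ≫ (λ_ (E.tMap f)).hom := by
      rintro _ rfl
      simp
    exact this _

/-- The lifting data of a duplicial structure. -/
noncomputable def liftingData : LiftingData B where
  tObj := E.tObj
  eps x := E.tMap (𝟙 x)
  tMap := E.tMap
  counit := E.counit
  isRightLifting := E.isRightLifting
  tMap_id _ := rfl
  tMap_tMap_id := E.tMap_tMap_id
  counit_tMap_id x := by simpa using E.counit_tMap_id x

theorem liftingData_isNormalized : E.liftingData.IsNormalized :=
  fun x => (E.counit_id x).trans (Category.comp_id _).symm

end CellData

/-! ### Lifting data induced by a duplicial structure -/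

/-- A duplicial structure `D` induces lifting data `L` if `D` sends `x` to `t x`, `f` to `t f`,
and `s₁ f` to `ε_f`. -/
structure Induces (L : LiftingData B) : Prop where
  act_vertex (x : B) : D.act 0 (vertex x) = vertex (L.tObj x)
  act_edge {a x : B} (f : a ⟶ x) : D.act 1 (edge f) = edge (L.tMap f)
  act_degen {a x : B} (f : a ⟶ x) : D.act 2 (degen 1 (edge f)) = triangle (L.counit f)

/-- Every duplicial structure induces normalized lifting data. -/
theorem exists_induces : ∃ L : LiftingData B, L.IsNormalized ∧ D.Induces L := by
  obtain ⟨E⟩ := D.nonempty_cellData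
  exact ⟨E.liftingData, E.liftingData_isNormalized, E.act_vertex, E.act_edge,
    E.act_degen_one_edge⟩

variable {D}

namespace Induces

/-- The effect on objects and 1-cells of a duplicial structure inducing `L`. -/
abbrev cellData {L : LiftingData B} (h : D.Induces L) : D.CellData where
  tObj := L.tObj
  tMap := L.tMap
  act_vertex := h.act_vertex
  act_edge := h.act_edge

theorem counit_eq {L : LiftingData B} (h : D.Induces L) {a x : B} (f : a ⟶ x) :
    h.cellData.counit f = L.counit f ≫ eqToHom (L.tMap_id x).symm := by
  have e : triangle (h.cellData.counit f) = triangle (L.counit f) := by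
    rw [← h.act_degen, h.cellData.act_degen_one_edge]
  simpa using (triangle_eq_iff_cast rfl (L.tMap_id x)).1 e

/-- The transposes of a 2-cell under two duplicial structures inducing the same lifting data are the
same factorization through a right lifting. -/
theorem transpose_eq {D' : DuplicialStructure (bicatNerve B)} {L : LiftingData B}
    (h : D.Induces L) (h' : D'.Induces L) {x y z : B} {f : x ⟶ y} {g : y ⟶ z} {k : x ⟶ z}
    (α : f ≫ g ⟶ k) : h.cellData.transpose α = h'.cellData.transpose α := by
  refine (nonempty_isKan_iff.1 (h.cellData.isRightLifting g) _ _).unique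
    (h.cellData.transpose_whiskerRight_counit α) ?_
  have e : ∀ {a x : B} (f : a ⟶ x), h.cellData.counit f = h'.cellData.counit f := by
    intro a x f
    rw [h.counit_eq, h'.counit_eq]
  rw [e, e]
  exact h'.cellData.transpose_whiskerRight_counit α

/-- Lifting data determine the duplicial structure inducing them. -/
theorem duplicial_unique {D' : DuplicialStructure (bicatNerve B)} {L : LiftingData B}
    (h : D.Induces L) (h' : D'.Induces L) : D = D' := by
  refine ext_of_act fun n hn s => ?_
  match n, hn, s with
  | 0, _, s => rw [eq_vertex s, h.act_vertex, h'.act_vertex]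
  | 1, _, s => rw [eq_edge s, h.act_edge, h'.act_edge]
  | 2, _, s => rw [eq_triangle s, h.cellData.act_triangle, h'.cellData.act_triangle,
      transpose_eq h h']

/-- A duplicial structure determines the lifting data it induces. -/
theorem lifting_unique {L L' : LiftingData B} (h : D.Induces L) (h' : D.Induces L') :
    L = L' := by
  have hO (x : B) : L.tObj x = L'.tObj x :=
    vertex_injective ((h.act_vertex x).symm.trans (h'.act_vertex x))
  have hM {a x : B} (f : a ⟶ x) := (edge_eq_iff.1 ((h.act_edge f).symm.trans (h'.act_edge f))).2.2
  have hC {a x : B} (f : a ⟶ x) :=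
    (triangle_eq_iff.1 ((h.act_degen f).symm.trans (h'.act_degen f))).2.2.2.2.2
  clear h h'
  obtain ⟨tObj, eps, tMap, counit, _, _, _, _⟩ := L
  obtain ⟨tObj', eps', tMap', counit', _, _, _, _⟩ := L'
  obtain rfl : tObj = tObj' := funext hO
  obtain rfl : @tMap = @tMap' := by
    funext a x f
    exact eq_of_heq (hM f)
  obtain rfl : eps = eps' := by
    funext x
    exact eq_of_heq (hC (𝟙 x)).1
  obtain rfl : @counit = @counit' := by
    funext a x f
    exact eq_of_heq (hC f).2
  rfl

end Induces

end DuplicialStructure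

/-! ### The duplicial structure induced by normalized lifting data -/

namespace LiftingData

open BicatSimplex

variable {B : Type u} [Bicategory.{w, v} B] (L : LiftingData B)

theorem existsUnique_factor {a x : B} {f : a ⟶ x} {k : L.tObj x ⟶ a} (β : k ≫ f ⟶ L.eps x) :
    ∃! γ : k ⟶ L.tMap f, γ ▷ f ≫ L.counit f = β :=
  nonempty_isKan_iff.1 (L.isRightLifting f) k β

theorem hom_ext {a x : B} {f : a ⟶ x} {k : L.tObj x ⟶ a} {γ γ' : k ⟶ L.tMap f}
    (h : γ ▷ f ≫ L.counit f = γ' ▷ f ≫ L.counit f) : γ = γ' :=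
  (L.existsUnique_factor _).unique h rfl

/-- The 2-cell `t h ≫ f ⟶ t g` corresponding to `f ≫ g ⟶ h` under the universal property of
the right lifting `t g`. -/
noncomputable def transpose {x y z : B} {f : x ⟶ y} {g : y ⟶ z} {h : x ⟶ z} (c : f ≫ g ⟶ h) :
    L.tMap h ≫ f ⟶ L.tMap g :=
  (L.existsUnique_factor ((α_ (L.tMap h) f g).hom ≫ L.tMap h ◁ c ≫ L.counit h)).choose

theorem transpose_whiskerRight_counit {x y z : B} {f : x ⟶ y} {g : y ⟶ z} {h : x ⟶ z}
    (c : f ≫ g ⟶ h) :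
    L.transpose c ▷ g ≫ L.counit g = (α_ (L.tMap h) f g).hom ≫ L.tMap h ◁ c ≫ L.counit h :=
  (L.existsUnique_factor _).choose_spec.1

theorem transpose_leftUnitor {x y : B} {m : x ⟶ x} (p : m = 𝟙 x) (f : x ⟶ y) :
    L.transpose (eqToHom p ▷ f ≫ (λ_ f).hom) = L.tMap f ◁ eqToHom p ≫ (ρ_ (L.tMap f)).hom := by
  subst p
  apply L.hom_ext
  rw [transpose_whiskerRight_counit]
  simp

/-- Transposition preserves commuting tetrahedra; this is the last axiom for the simplex `t s`. -/
theorem transpose_comm {x₀ x₁ x₂ x₃ : B} {f : x₀ ⟶ x₁} {g : x₁ ⟶ x₂} {h : x₂ ⟶ x₃}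
    {fg : x₀ ⟶ x₂} {gh : x₁ ⟶ x₃} {fgh : x₀ ⟶ x₃} {a : f ≫ g ⟶ fg} {b : g ≫ h ⟶ gh}
    {c : fg ≫ h ⟶ fgh} {d : f ≫ gh ⟶ fgh}
    (e : a ▷ h ≫ c = (α_ f g h).hom ≫ f ◁ b ≫ d) :
    L.transpose d ▷ g ≫ L.transpose b =
      (α_ (L.tMap fgh) f g).hom ≫ L.tMap fgh ◁ a ≫ L.transpose c := by
  apply L.hom_ext
  calc (L.transpose d ▷ g ≫ L.transpose b) ▷ h ≫ L.counit h
    _ = (α_ (L.tMap fgh ≫ f) g h).hom ≫ (L.tMap fgh ≫ f) ◁ b ≫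
          L.transpose d ▷ gh ≫ L.counit gh := by
        rw [comp_whiskerRight, Category.assoc, transpose_whiskerRight_counit,
          whisker_exchange_assoc]
        simp
    _ = (α_ (L.tMap fgh) f g).hom ▷ h ≫ (α_ (L.tMap fgh) (f ≫ g) h).hom ≫
          L.tMap fgh ◁ ((α_ f g h).hom ≫ f ◁ b ≫ d) ≫ L.counit fgh := by
        rw [transpose_whiskerRight_counit]
        simp
    _ = ((α_ (L.tMap fgh) f g).hom ≫ L.tMap fgh ◁ a ≫ L.transpose c) ▷ h ≫ L.counit h := by
        rw [← e]
        simp [transpose_whiskerRight_counit]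

/-- The `n`-simplex whose initial vertex is the `t` of the vertex `top` of `s`, and whose other
vertices are those of `s` selected by `θ`, none of them beyond `top`. -/
noncomputable def shift {N n : ℕ} (s : BicatSimplex B N) (top : Fin (N + 1))
    (θ : Fin n →o Fin (N + 1)) (hθ : ∀ i, θ i ≤ top) : BicatSimplex B n :=
  cone s θ (L.tObj (s.obj top)) (fun i => L.tMap (s.map (θ i) top (hθ i)))
    (fun i j h => L.transpose (s.comp (θ i) (θ j) top (θ.monotone h) (hθ j)))
    (fun i => by rw [s.id_comp]; exact L.transpose_leftUnitor _ _)
    (fun _ _ _ _ _ => L.transpose_comm (s.assoc _ _ _ _ _ _ _))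

theorem shift_congr {N n : ℕ} (s : BicatSimplex B N) {top top' : Fin (N + 1)}
    {θ θ' : Fin n →o Fin (N + 1)} (hθ : ∀ i, θ i ≤ top) (h : top = top')
    (h' : ∀ i, θ i = θ' i) :
    L.shift s top θ hθ = L.shift s top' θ' (fun i => h' i ▸ h ▸ hθ i) := by
  obtain rfl := h
  obtain rfl : θ = θ' := OrderHom.ext _ _ (funext h')
  rfl

/-- The action `tₙ` of lifting data on `n`-simplices. -/
noncomputable def act (n : ℕ) (s : BicatSimplex B n) : BicatSimplex B n :=
  L.shift s (Fin.last n) Fin.castSuccOrderEmb.toOrderHom fun _ => Fin.le_last _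

/-- Acting on a restricted simplex amounts to restricting the choice of vertices. -/
theorem act_precomp {m n : ℕ} (φ : Fin (m + 1) →o Fin (n + 1)) (s : BicatSimplex B n) :
    L.act m (s.precomp φ) =
      L.shift s (φ (Fin.last m)) (φ.comp Fin.castSuccOrderEmb.toOrderHom)
        fun _ => φ.monotone (Fin.le_last _) := rfl

theorem precomp_shift {N m n : ℕ} (s : BicatSimplex B N) (top : Fin (N + 1))
    (θ : Fin n →o Fin (N + 1)) (hθ : ∀ i, θ i ≤ top) (χ : Fin (m + 1) →o Fin (n + 1))
    (ψ : Fin m →o Fin n) (h₀ : χ 0 = 0) (h : ∀ i, χ i.succ = (ψ i).succ) :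
    (L.shift s top θ hθ).precomp χ = L.shift s top (θ.comp ψ) fun _ => hθ _ := by
  -- On this form of `χ` the values at `0` and at successors hold by definition.
  let χ' : Fin (m + 1) →o Fin (n + 1) :=
    { toFun i := match i with
        | ⟨0, _⟩ => 0
        | ⟨i + 1, hi⟩ => (ψ ⟨i, Nat.lt_of_succ_lt_succ hi⟩).succ
      monotone' := by
        rintro ⟨_ | i, hi⟩ ⟨_ | j, hj⟩ hij
        · exact le_rfl
        · exact Fin.zero_le _
        · exact absurd hij (Nat.not_succ_le_zero i)
        · exact Fin.succ_le_succ_iff.2 (ψ.monotone (Nat.le_of_succ_le_succ hij)) }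
  obtain rfl : χ = χ' := by
    ext i : 2
    exact Fin.cases h₀ h i
  refine ext_heq ?_ ?_ ?_
  · rintro ⟨_ | i, hi⟩ <;> rfl
  · rintro ⟨_ | i, hi⟩ ⟨_ | j, hj⟩ hij
    all_goals first
      | exact absurd hij (Nat.not_succ_le_zero _)
      | exact HEq.rfl
  · rintro ⟨_ | i, hi⟩ ⟨_ | j, hj⟩ ⟨_ | k, hk⟩ hij hjk
    all_goals first
      | exact absurd hij (Nat.not_succ_le_zero _)
      | exact absurd hjk (Nat.not_succ_le_zero _)
      | exact HEq.rfl

/-- Compatibility of `t` with an operator `φ` that preserves and reflects the last vertex,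
given on the other vertices by `ψ`. -/
theorem precomp_act {m n : ℕ} (s : BicatSimplex B n) (χ φ : Fin (m + 1) →o Fin (n + 1))
    (ψ : Fin m →o Fin n) (h₀ : χ 0 = 0) (h : ∀ i, χ i.succ = (ψ i).succ)
    (h₁ : φ (Fin.last m) = Fin.last n) (h' : ∀ i, φ i.castSucc = (ψ i).castSucc) :
    (L.act n s).precomp χ = L.act m (s.precomp φ) := by
  rw [act_precomp, act, L.precomp_shift s _ _ _ χ ψ h₀ h]
  exact (L.shift_congr s _ h₁ h').symm

theorem face_zero_act {n : ℕ} (s : BicatSimplex B (n + 1)) :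
    face 0 (L.act (n + 1) s) = face (Fin.last (n + 1)) s := by
  have h₀ : (SimplexCategory.δ (0 : Fin (n + 2))).toOrderHom =
      (Fin.succOrderEmb (n + 1)).toOrderHom := by
    ext i : 2
    exact Fin.succAbove_zero_apply i
  have h₁ : (SimplexCategory.δ (Fin.last (n + 1))).toOrderHom =
      (Fin.castSuccOrderEmb (n := n + 1)).toOrderHom := by
    ext i : 2
    exact Fin.succAbove_last_apply i
  rw [face, face, h₀, h₁]
  rfl

theorem face_succ_act {n : ℕ} (i : Fin (n + 1)) (s : BicatSimplex B (n + 1)) :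
    face i.succ (L.act (n + 1) s) = L.act n (face i.castSucc s) := by
  refine L.precomp_act s _ _ (Fin.succAboveOrderEmb i).toOrderHom ?_ ?_ ?_ ?_
  · exact Fin.succ_succAbove_zero i
  · exact fun j => Fin.succ_succAbove_succ i j
  · exact Fin.succAbove_ne_last_last (Fin.castSucc_ne_last i)
  · exact fun j => Fin.castSucc_succAbove_castSucc

theorem degen_succ_act {n : ℕ} (i : Fin (n + 1)) (s : BicatSimplex B (n + 1)) :
    degen i.succ (L.act (n + 1) s) = L.act (n + 2) (degen i.castSucc s) := by
  refine L.precomp_act s _ _ (SimplexCategory.σ i).toOrderHom ?_ ?_ ?_ ?_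
  · exact Fin.predAbove_right_zero (i := i.succ)
  · exact fun j => Fin.succ_predAbove_succ i j
  · exact Fin.predAbove_right_last
  · exact fun j => Fin.castSucc_predAbove_castSucc i j

theorem tMap_tMap_eq {x : B} {m : x ⟶ x} (p : m = 𝟙 x) : L.tMap (L.tMap m) = 𝟙 (L.tObj x) := by
  rw [p, L.tMap_tMap_id]

variable {L}

/-- Normalized lifting data have `ε_f` as the transpose of the right unit constraint of `f`. -/
theorem IsNormalized.transpose_rightUnitor (hL : L.IsNormalized) {a x : B} (f : a ⟶ x) :
    L.transpose (ρ_ f).hom = L.counit f ≫ eqToHom (L.tMap_id x).symm := by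
  apply L.hom_ext
  rw [transpose_whiskerRight_counit, hL]
  simp

/-- The transpose of `ε_f` is an identity. The 1-cell `m` is only propositionally an identity,
as is the edge of a simplex from a vertex to itself. -/
theorem IsNormalized.transpose_transpose (hL : L.IsNormalized) {a x : B} {m : x ⟶ x}
    (p : m = 𝟙 x) (f : a ⟶ x) :
    HEq (L.transpose (L.transpose (f ◁ eqToHom p ≫ (ρ_ f).hom))) (λ_ (L.tMap f)).hom := by
  subst p
  have h : L.transpose (L.transpose (ρ_ f).hom) =
      eqToHom (L.tMap_tMap_id x) ▷ L.tMap f ≫ (λ_ (L.tMap f)).hom := by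
    apply L.hom_ext
    rw [transpose_whiskerRight_counit, L.counit_tMap_id, hL.transpose_rightUnitor]
    have key : ∀ {m : L.tObj x ⟶ L.tObj x} (p : m = 𝟙 _) {e : L.tObj x ⟶ x} (q : e = L.eps x),
        (α_ m (L.tMap f) f).hom ≫ m ◁ (L.counit f ≫ eqToHom q.symm) ≫
          eqToHom p ▷ e ≫ (λ_ e).hom ≫ eqToHom q =
        (eqToHom p ▷ L.tMap f ≫ (λ_ (L.tMap f)).hom) ▷ f ≫ L.counit f := by
      rintro _ rfl _ rfl
      simp
    exact key _ _
  have key : ∀ {m : L.tObj x ⟶ L.tObj x} (p : m = 𝟙 _) {k : L.tObj x ⟶ a},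
      HEq (eqToHom p ▷ k ≫ (λ_ k).hom) (λ_ k).hom := by
    rintro _ rfl k
    simp
  rw [← rightUnitor_hom_eq, h]
  exact key _

/-- The duplicial identity `s₀ tₙ = tₙ₊₁² sₙ`. The vertices of `t² sₙ s` are `t sₙ`, `t sₙ`, `s₀`,
…, `sₙ₋₁`, and its only 2-cells that do not agree with those of `s₀ t s` by definition are
those between the first two vertices and a third. -/
theorem IsNormalized.degen_zero_act (hL : L.IsNormalized) {n : ℕ} (s : BicatSimplex B n) :
    degen 0 (L.act n s) = L.act (n + 1) (L.act (n + 1) (degen (Fin.last n) s)) := by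
  -- A form of the degeneracy `σ 0` whose values at `0` and at successors hold by definition.
  let χ : Fin (n + 2) →o Fin (n + 1) :=
    { toFun i := match i with
        | ⟨0, _⟩ => 0
        | ⟨i + 1, hi⟩ => ⟨i, Nat.lt_of_succ_lt_succ hi⟩
      monotone' := by
        rintro ⟨_ | i, hi⟩ ⟨_ | j, hj⟩ hij
        · exact le_rfl
        · exact Fin.zero_le _
        · exact absurd hij (Nat.not_succ_le_zero i)
        · exact Nat.le_of_succ_le_succ hij }
  have hχ : (SimplexCategory.σ (0 : Fin (n + 1))).toOrderHom = χ := by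
    ext i : 2
    refine Fin.cases ?_ (fun i => ?_) i
    · exact Fin.predAbove_right_zero (i := 0)
    · exact Fin.predAbove_zero_succ
  have h : L.act (n + 1) (degen (Fin.last n) s) =
      L.shift s (Fin.last n) OrderHom.id fun _ => Fin.le_last _ := by
    refine (L.act_precomp _ s).trans (L.shift_congr s _ ?_ fun i => ?_)
    · exact Fin.predAbove_right_last
    · exact Fin.predAbove_last_castSucc
  rw [h, degen, hχ]
  refine ext_of_lt ?_ ?_ ?_
  · rintro ⟨_ | _ | i, hi⟩ <;> rfl
  · rintro ⟨_ | _ | i, hi⟩ ⟨_ | _ | j, hj⟩ hij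
    · exact absurd hij (lt_irrefl _)
    · exact heq_of_eq (L.tMap_tMap_eq (s.map_id (Fin.last n))).symm
    · exact HEq.rfl
    · exact absurd hij (Nat.not_lt_zero _)
    · exact absurd hij (lt_irrefl _)
    · exact HEq.rfl
    · exact absurd hij (Nat.not_lt_zero _)
    · exact absurd (Nat.lt_of_succ_lt_succ hij) (Nat.not_lt_zero _)
    · exact HEq.rfl
  · rintro ⟨_ | _ | i, hi⟩ ⟨_ | _ | j, hj⟩ ⟨_ | _ | k, hk⟩ hij hjk
    all_goals first
      | exact absurd hij (lt_irrefl _)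
      | exact absurd hjk (lt_irrefl _)
      | exact absurd hij (Nat.not_lt_zero _)
      | exact absurd hjk (Nat.not_lt_zero _)
      | exact absurd (Nat.lt_of_succ_lt_succ hij) (Nat.not_lt_zero _)
      | exact absurd (Nat.lt_of_succ_lt_succ hjk) (Nat.not_lt_zero _)
      | exact HEq.rfl
      | skip
    -- The remaining 2-cell has vertices 0, 1 and `i + 2`.
    have e : ∀ (i : Fin (n + 1)) {c}
        (hc : c = s.comp i (Fin.last n) (Fin.last n) (Fin.le_last _) le_rfl),
        HEq (λ_ (L.tMap (s.map i (Fin.last n) (Fin.le_last _)))).hom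
          (L.transpose (L.transpose c)) := by
      intro i c hc
      rw [hc, s.comp_id]
      exact (hL.transpose_transpose (s.map_id _) _).symm
    exact e _ rfl

/-- The duplicial structure on the nerve induced by normalized lifting data. -/
noncomputable def IsNormalized.duplicialStructure (hL : L.IsNormalized) :
    DuplicialStructure (bicatNerve B) where
  t n := TypeCat.ofHom (L.act n)
  t_δ_zero n := by
    ext s
    exact L.face_zero_act s
  t_δ_succ n i := by
    ext s
    exact L.face_succ_act i s
  t_σ_zero n := by
    ext s
    exact hL.degen_zero_act s
  t_σ_succ n i := by
    ext s
    exact L.degen_succ_act i s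

theorem IsNormalized.induces (hL : L.IsNormalized) : hL.duplicialStructure.Induces L where
  act_vertex x := eq_vertex _
  act_edge f := eq_edge _
  act_degen {a x} f := by
    rw [← triangle_comp_eqToHom (L.counit f) (L.tMap_id x).symm, ← hL.transpose_rightUnitor]
    exact eq_triangle _

/-! ### Normalization of lifting data -/

/-- If `ε_{t 1_x}` is the right unit constraint because `t 1_x` is itself an identity, then it is
also the left unit constraint. -/
theorem eq_of_heq_rightUnitor {a x y : B} {e e' : a ⟶ x} {m : a ⟶ a} (p : m = 𝟙 a) (q : e = e')
    (c : m ≫ e ⟶ e') (hc : HEq c (ρ_ m).hom) (he : edge e = edge (𝟙 y)) :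
    c = eqToHom p ▷ e ≫ (λ_ e).hom ≫ eqToHom q := by
  subst p q
  obtain ⟨rfl, rfl, h⟩ := edge_eq_iff.1 he
  obtain rfl := eq_of_heq h
  rw [eq_of_heq hc]
  simp [unitors_equal]

variable (L)

/-- The 2-cell to be used as `ε_f` in the normalization of lifting data. -/
theorem exists_normalized_counit {a x : B} (f : a ⟶ x) :
    ∃ c : L.tMap f ≫ f ⟶ L.eps x,
      Nonempty (RightLift.IsKan (RightLift.mk (L.tMap f) c)) ∧
      (∀ y : B, edge f = edge (𝟙 y) → HEq c (ρ_ (L.tMap f)).hom) ∧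
      ((∀ y : B, edge f ≠ edge (𝟙 y)) → c = L.counit f) := by
  by_cases hf : ∃ y : B, edge f = edge (𝟙 y)
  · obtain ⟨y, hy⟩ := hf
    obtain ⟨rfl, rfl, h⟩ := edge_eq_iff.1 hy
    obtain rfl := eq_of_heq h
    have key : ∀ {e : L.tObj x ⟶ x} (q : L.tMap (𝟙 x) = e), ∃ c : L.tMap (𝟙 x) ≫ 𝟙 x ⟶ e,
        Nonempty (RightLift.IsKan (RightLift.mk (L.tMap (𝟙 x)) c)) ∧
          HEq c (ρ_ (L.tMap (𝟙 x))).hom := by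
      rintro _ rfl
      exact ⟨_, nonempty_isKan_rightUnitor _, HEq.rfl⟩
    obtain ⟨c, hc, hc'⟩ := key (L.tMap_id x)
    exact ⟨c, hc, fun _ _ => hc', fun h => absurd rfl (h x)⟩
  · push Not at hf
    exact ⟨L.counit f, L.isRightLifting f, fun y hy => absurd hy (hf y), fun _ => rfl⟩

/-- Lifting data can be normalized, changing only the 2-cells `ε_f` with `f` an identity. -/
noncomputable def normalize : LiftingData B where
  tObj := L.tObj
  eps := L.eps
  tMap := L.tMap
  counit f := (L.exists_normalized_counit f).choose
  isRightLifting f := (L.exists_normalized_counit f).choose_spec.1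
  tMap_id := L.tMap_id
  tMap_tMap_id := L.tMap_tMap_id
  counit_tMap_id x := by
    by_cases h : ∃ y : B, edge (L.tMap (𝟙 x)) = edge (𝟙 y)
    · obtain ⟨y, hy⟩ := h
      exact eq_of_heq_rightUnitor _ _ _
        ((L.exists_normalized_counit (L.tMap (𝟙 x))).choose_spec.2.1 y hy) hy
    · push Not at h
      rw [(L.exists_normalized_counit (L.tMap (𝟙 x))).choose_spec.2.2 h, L.counit_tMap_id]

theorem isNormalized_normalize : L.normalize.IsNormalized := by
  intro x
  have key : ∀ {e : L.tObj x ⟶ x} (q : L.tMap (𝟙 x) = e) (c : L.tMap (𝟙 x) ≫ 𝟙 x ⟶ e),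
      HEq c (ρ_ (L.tMap (𝟙 x))).hom → c = (ρ_ (L.tMap (𝟙 x))).hom ≫ eqToHom q := by
    rintro _ rfl c hc
    simpa using hc
  exact key (L.tMap_id x) _ ((L.exists_normalized_counit (𝟙 x)).choose_spec.2.1 x rfl)

theorem normalize_counit {a x : B} (f : a ⟶ x) (h : ∀ y : B, edge f ≠ edge (𝟙 y)) :
    L.normalize.counit f = L.counit f :=
  (L.exists_normalized_counit f).choose_spec.2.2 h

/-- A duplicial structure acts on `s₁ 1_x` by the identity, so that inducing the normalization
of `L` is a condition on 1-cells other than identities. -/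
theorem induces_normalize_iff (D : DuplicialStructure (bicatNerve B)) :
    D.Induces L.normalize ↔
      (∀ x : B, D.act 0 (vertex x) = vertex (L.tObj x)) ∧
      (∀ {a x : B} (f : a ⟶ x), D.act 1 (edge f) = edge (L.tMap f)) ∧
      (∀ {a x : B} (f : a ⟶ x), (∀ y : B, edge f ≠ edge (𝟙 y)) →
        D.act 2 (degen 1 (edge f)) = triangle (L.counit f)) := by
  refine ⟨fun h => ⟨h.act_vertex, h.act_edge, fun f hf => ?_⟩, fun ⟨h₀, h₁, h₂⟩ =>
    ⟨h₀, h₁, fun {a x} f => ?_⟩⟩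
  · rw [h.act_degen, normalize_counit L f hf]
    rfl
  · by_cases hf : ∃ y : B, edge f = edge (𝟙 y)
    · obtain ⟨y, hy⟩ := hf
      obtain ⟨rfl, rfl, h⟩ := edge_eq_iff.1 hy
      obtain rfl := eq_of_heq h
      let E : D.CellData := ⟨L.tObj, L.tMap, h₀, h₁⟩
      rw [E.act_degen_one_edge, E.counit_id, L.isNormalized_normalize]
      exact (triangle_comp_eqToHom _ (L.tMap_id x)).symm
    · push Not at hf
      rw [h₂ f hf, normalize_counit L f hf]
      rfl

end LiftingData

/-! ### `*`-autonomous categories -/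

namespace StarAutonomousStructure

open scoped MonoidalCategory
open MonoidalCategory

variable {C : Type u} [Category.{v} C] [MonoidalCategory C] (S : StarAutonomousStructure C)

/-- The dual `x*`. -/
def dual (x : C) : C := (S.star.functor.obj x).unop

/-- The dual of a morphism. -/
def dualMap {x y : C} (g : x ⟶ y) : S.dual y ⟶ S.dual x := (S.star.functor.map g).unop

theorem dualMap_id (x : C) : S.dualMap (𝟙 x) = 𝟙 (S.dual x) := by
  simp [dualMap, dual]

theorem dualMap_comp {x y z : C} (g : x ⟶ y) (h : y ⟶ z) :
    S.dualMap (g ≫ h) = S.dualMap h ≫ S.dualMap g :=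
  congrArg Quiver.Hom.unop (S.star.functor.map_comp g h)

theorem dualMap_bijective (x y : C) :
    Function.Bijective (S.dualMap : (x ⟶ y) → (S.dual y ⟶ S.dual x)) := by
  constructor
  · intro g h e
    exact S.star.functor.map_injective (Quiver.Hom.unop_inj e)
  · intro φ
    obtain ⟨g, hg⟩ := S.star.functor.map_surjective φ.op
    exact ⟨g, congrArg Quiver.Hom.unop hg⟩

/-- The isomorphism exhibiting an object as the dual of its image under the inverse of `(-)*`. -/
def dualInverseIso (z : C) : S.dual (S.star.inverse.obj (op z)) ≅ z :=
  ((S.star.counitIso.app (op z)).unop).symm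

/-- The bijection `C(x, y*) ≃ C(𝟙, (x ⊗ y)*)`. -/
def dualHomEquiv (x y : C) : (x ⟶ S.dual y) ≃ (𝟙_ C ⟶ S.dual (x ⊗ y)) := S.homEquiv x y

theorem dualHomEquiv_comp {x x' y : C} (g : x' ⟶ x) (φ : x ⟶ S.dual y) :
    S.dualHomEquiv x' y (g ≫ φ) = S.dualHomEquiv x y φ ≫ S.dualMap (g ▷ y) :=
  S.naturality_left y g φ

theorem dualHomEquiv_comp_dualMap {x y y' : C} (h : y' ⟶ y) (φ : x ⟶ S.dual y) :
    S.dualHomEquiv x y' (φ ≫ S.dualMap h) = S.dualHomEquiv x y φ ≫ S.dualMap (x ◁ h) :=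
  S.naturality_right x h φ

/-- The dual of an isomorphism. -/
def dualIso {x y : C} (e : x ≅ y) : S.dual y ≅ S.dual x where
  hom := S.dualMap e.hom
  inv := S.dualMap e.inv
  hom_inv_id := by rw [← dualMap_comp, e.inv_hom_id, dualMap_id]
  inv_hom_id := by rw [← dualMap_comp, e.hom_inv_id, dualMap_id]

/-- Writing `ε` for the dual of the unit, `x*` represents `C(- ⊗ x, ε)`. -/
def curryEquiv (k x : C) : (k ⟶ S.dual x) ≃ (k ⊗ x ⟶ S.dual (𝟙_ C)) :=
  ((S.dualHomEquiv k x).trans (S.dualIso (ρ_ (k ⊗ x))).homToEquiv).trans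
    (S.dualHomEquiv (k ⊗ x) (𝟙_ C)).symm

theorem dualHomEquiv_curryEquiv {k x : C} (φ : k ⟶ S.dual x) :
    S.dualHomEquiv (k ⊗ x) (𝟙_ C) (S.curryEquiv k x φ) =
      S.dualHomEquiv k x φ ≫ S.dualMap (ρ_ (k ⊗ x)).hom :=
  Equiv.apply_symm_apply _ _

theorem curryEquiv_comp {k k' x : C} (g : k' ⟶ k) (φ : k ⟶ S.dual x) :
    S.curryEquiv k' x (g ≫ φ) = g ▷ x ≫ S.curryEquiv k x φ := by
  apply (S.dualHomEquiv (k' ⊗ x) (𝟙_ C)).injective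
  rw [dualHomEquiv_comp, dualHomEquiv_curryEquiv, dualHomEquiv_curryEquiv, dualHomEquiv_comp,
    Category.assoc, Category.assoc, ← dualMap_comp, ← dualMap_comp,
    MonoidalCategory.rightUnitor_naturality]

theorem curryEquiv_comp_dualMap {k x x' : C} (h : x' ⟶ x) (φ : k ⟶ S.dual x) :
    S.curryEquiv k x' (φ ≫ S.dualMap h) = k ◁ h ≫ S.curryEquiv k x φ := by
  apply (S.dualHomEquiv (k ⊗ x') (𝟙_ C)).injective
  rw [dualHomEquiv_comp, dualHomEquiv_curryEquiv, dualHomEquiv_curryEquiv,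
    dualHomEquiv_comp_dualMap, Category.assoc, Category.assoc, ← dualMap_comp, ← dualMap_comp,
    MonoidalCategory.rightUnitor_naturality]

/-- The morphism `𝟙 ⟶ 𝟙**` corresponding to the left unit constraint of `ε = 𝟙*`. -/
def unitDoubleDual : 𝟙_ C ⟶ S.dual (S.dual (𝟙_ C)) :=
  (S.curryEquiv _ _).symm (λ_ (S.dual (𝟙_ C))).hom

/-- `g ↦ u ≫ g*` is the composite bijection `C(y, ε) ≃ C(𝟙 ⊗ y, ε) ≃ C(𝟙, y*)`. -/
theorem unitDoubleDual_comp_dualMap_bijective (y : C) :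
    Function.Bijective fun g : y ⟶ S.dual (𝟙_ C) => S.unitDoubleDual ≫ S.dualMap g := by
  have h : ∀ g : y ⟶ S.dual (𝟙_ C), S.unitDoubleDual ≫ S.dualMap g =
      (S.curryEquiv _ _).symm ((λ_ y).hom ≫ g) := by
    intro g
    rw [Equiv.eq_symm_apply, curryEquiv_comp_dualMap, unitDoubleDual, Equiv.apply_symm_apply,
      MonoidalCategory.leftUnitor_naturality]
  simp only [h]
  refine (S.curryEquiv _ _).symm.bijective.comp ⟨fun g g' e => ?_, fun φ => ?_⟩
  · exact (cancel_epi _).1 e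
  · exact ⟨(λ_ y).inv ≫ φ, by simp⟩

/-- By the Yoneda lemma the unit is isomorphic to its double dual. -/
theorem isIso_unitDoubleDual : IsIso S.unitDoubleDual := by
  let j := S.dualInverseIso (𝟙_ C)
  obtain ⟨g, hg⟩ := (S.unitDoubleDual_comp_dualMap_bijective _).2 j.inv
  have h : S.unitDoubleDual ≫ S.dualMap g ≫ j.hom = 𝟙 _ := by
    change S.unitDoubleDual ≫ S.dualMap g = j.inv at hg
    rw [← Category.assoc, hg, j.inv_hom_id]
  refine ⟨S.dualMap g ≫ j.hom, h, ?_⟩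
  obtain ⟨e, he⟩ := (S.dualMap_bijective _ _).2 ((S.dualMap g ≫ j.hom) ≫ S.unitDoubleDual)
  rw [← he, ← S.dualMap_id]
  congr 1
  apply (S.unitDoubleDual_comp_dualMap_bijective _).1
  change _ ≫ S.dualMap e = _ ≫ S.dualMap (𝟙 _)
  rw [he, dualMap_id, ← Category.assoc, h, Category.id_comp, Category.comp_id]

/-- The dual `x*` is the right lifting of `ε` through `x`. -/
theorem existsUnique_dual {k x : C} (β : k ⊗ x ⟶ S.dual (𝟙_ C)) :
    ∃! γ : k ⟶ S.dual x, γ ▷ x ≫ S.curryEquiv _ _ (𝟙 (S.dual x)) = β := by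
  have h : ∀ γ : k ⟶ S.dual x, γ ▷ x ≫ S.curryEquiv _ _ (𝟙 (S.dual x)) = S.curryEquiv _ _ γ :=
    fun γ => by rw [← curryEquiv_comp, Category.comp_id]
  simp only [h]
  exact (S.curryEquiv k x).bijective.existsUnique β

/-- The unit is the right lifting of `ε` through `ε`. -/
theorem existsUnique_unit {k : C} (β : k ⊗ S.dual (𝟙_ C) ⟶ S.dual (𝟙_ C)) :
    ∃! γ : k ⟶ 𝟙_ C, γ ▷ S.dual (𝟙_ C) ≫ (λ_ (S.dual (𝟙_ C))).hom = β := by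
  have := S.isIso_unitDoubleDual
  have h : ∀ γ : k ⟶ 𝟙_ C, γ ▷ S.dual (𝟙_ C) ≫ (λ_ (S.dual (𝟙_ C))).hom =
      S.curryEquiv _ _ (γ ≫ S.unitDoubleDual) := by
    intro γ
    rw [curryEquiv_comp, unitDoubleDual, Equiv.apply_symm_apply]
  simp only [h]
  refine Function.Bijective.existsUnique ((S.curryEquiv k _).bijective.comp
    ⟨fun g g' e => (cancel_mono _).1 e, fun φ => ⟨φ ≫ inv S.unitDoubleDual, by simp⟩⟩) β

/-- Right liftings of `ε` through all objects, chosen so as to be strictly compatible with the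
unit: `ε` for the unit and the unit for `ε`. -/
theorem exists_strict_lifting (f : C) :
    ∃ (t : C) (c : t ⊗ f ⟶ S.dual (𝟙_ C)),
      (∀ (k : C) (β : k ⊗ f ⟶ S.dual (𝟙_ C)), ∃! γ : k ⟶ t, γ ▷ f ≫ c = β) ∧
      (f = 𝟙_ C → t = S.dual (𝟙_ C)) ∧
      (f = S.dual (𝟙_ C) → t = 𝟙_ C ∧ HEq c (λ_ (S.dual (𝟙_ C))).hom) := by
  -- If `ε` is the unit, both requirements on `t` agree, and the case `f = ε` serves for both.
  by_cases h : f = S.dual (𝟙_ C)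
  · subst h
    exact ⟨𝟙_ C, (λ_ (S.dual (𝟙_ C))).hom, fun _ => S.existsUnique_unit, fun h => h.symm,
      fun _ => ⟨rfl, HEq.rfl⟩⟩
  · by_cases h' : f = 𝟙_ C
    · subst h'
      refine ⟨S.dual (𝟙_ C), (ρ_ (S.dual (𝟙_ C))).hom, fun k β =>
        ⟨(ρ_ k).inv ≫ β, by simp, fun γ hγ => ?_⟩, fun _ => rfl, fun e => absurd e h⟩
      simp [← hγ]
    · exact ⟨S.dual f, S.curryEquiv _ _ (𝟙 _), fun _ => S.existsUnique_dual,
        fun e => absurd e h', fun e => absurd e h⟩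

/-- A `*`-autonomous category, as a one-object bicategory, has lifting data. -/
theorem nonempty_liftingData (S : StarAutonomousStructure C) :
    Nonempty (LiftingData (MonoidalSingleObj C)) := by
  choose t c hc hu he using S.exists_strict_lifting
  have key : ∀ {m e : C} (p : m = 𝟙_ C) (q : e = S.dual (𝟙_ C))
      (c : m ⊗ e ⟶ S.dual (𝟙_ C)), HEq c (λ_ (S.dual (𝟙_ C))).hom →
      c = eqToHom p ▷ e ≫ (λ_ e).hom ≫ eqToHom q := by
    rintro _ _ rfl rfl c h
    simpa using h
  exact ⟨{
    tObj x := x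
    eps _ := S.dual (𝟙_ C)
    tMap f := t f
    counit f := c f
    isRightLifting f := nonempty_isKan_iff.2 (hc f)
    tMap_id _ := hu _ rfl
    tMap_tMap_id _ := (he _ (hu _ rfl)).1
    counit_tMap_id _ := key _ _ _ (he _ (hu _ rfl)).2 }⟩

end StarAutonomousStructure

theorem mainTheorem7 :
    (∀ (B : Type u) [Bicategory.{w, v} B],
      (∃ e : DuplicialStructure (bicatNerve B) ≃ {L : LiftingData B // L.IsNormalized},
        ∀ D : DuplicialStructure (bicatNerve B),
          (∀ x : B,
            D.t 0 (BicatSimplex.vertex x) = BicatSimplex.vertex ((e D).1.tObj x)) ∧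
          (∀ {a x : B} (f : a ⟶ x),
            D.t 1 (BicatSimplex.edge f) = BicatSimplex.edge ((e D).1.tMap f)) ∧
          (∀ {a x : B} (f : a ⟶ x),
            D.t 2 ((bicatNerve B).σ (1 : Fin 2) (BicatSimplex.edge f)) =
              BicatSimplex.triangle ((e D).1.counit f))) ∧
      (∀ L : LiftingData B, ∃! D : DuplicialStructure (bicatNerve B),
          (∀ x : B,
            D.t 0 (BicatSimplex.vertex x) = BicatSimplex.vertex (L.tObj x)) ∧
          (∀ {a x : B} (f : a ⟶ x),
            D.t 1 (BicatSimplex.edge f) = BicatSimplex.edge (L.tMap f)) ∧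
          (∀ {a x : B} (f : a ⟶ x),
            (∀ y : B, BicatSimplex.edge f ≠ BicatSimplex.edge (𝟙 y)) →
            D.t 2 ((bicatNerve B).σ (1 : Fin 2) (BicatSimplex.edge f)) =
              BicatSimplex.triangle (L.counit f)))) ∧
    (∀ (C : Type u) [Category.{v} C] [MonoidalCategory C],
      StarAutonomousStructure C →
        Nonempty (DuplicialStructure (bicatNerve (MonoidalSingleObj C)))) := by
  refine ⟨fun B _ => ⟨?_, fun L => ?_⟩, fun C _ _ S => ?_⟩
  · choose Φ hN hΦ using DuplicialStructure.exists_induces (B := B)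
    refine ⟨⟨fun D => ⟨Φ D, hN D⟩, fun L => L.2.duplicialStructure, fun D => ?_, fun L => ?_⟩,
      fun D => ⟨(hΦ D).act_vertex, (hΦ D).act_edge, (hΦ D).act_degen⟩⟩
    · exact (hN D).induces.duplicial_unique (hΦ D)
    · exact Subtype.ext ((hΦ _).lifting_unique L.2.induces)
  · refine ⟨L.isNormalized_normalize.duplicialStructure, ?_, fun D hD => ?_⟩
    · exact (L.induces_normalize_iff _).1 L.isNormalized_normalize.induces
    · exact ((L.induces_normalize_iff D).2 hD).duplicial_unique L.isNormalized_normalize.induces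
  · obtain ⟨L⟩ := S.nonempty_liftingData
    exact ⟨L.isNormalized_normalize.duplicialStructure⟩
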